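/- **Theorem.** There is a single deterministic parallel algorithm with the following property. Given a non-negative integer $m$, it halts after $\operatorname{polylog}(m)$ synchronous parallel steps, using $m^{O(\log m)}$ processors, and outputs a set $\mathcal W\subseteq\mathbb Z_{\ge 0}^m$ of at most $m^{O(\log m)}$ weight vectors, all of whose entries are at most $m^{O(\log m)}$, such that: for every field $\mathbb F$, every $n\ge 0$ and all two-dimensional subspaces ("lines") $l_1,\dots,l_m$ of $\mathbb F^n$, there is at least one $w\in\mathcal W$ for which the linear function $y\mapsto w\cdot y$ has a unique maximizer over the fractional linear matroid matching polytope $$P=\Bigl\{y\in\mathbb R^m_{\ge 0}\ :\ \sum_{i=1}^m y_i\,\dim(U\cap l_i)\le \dim U\ \text{ for all linear subspaces } U\subseteq\mathbb F^n\Bigr\}.$$ (Such a $w$ is called isolating for $P$.) The algorithm is one fixed program, independent of $m$, for a (priority CRCW) PRAM: processors with private registers and a shared memory, whose registers and memory cells hold words of $O(\log^2 m)$ bits; one step is one assignment, one of $+,-,\times$, integer division or remainder on words, one memory access, or one jump. The same program is run by all processors, which know their numbers; the input $m$ is placed in memory and the number of weight vectors and their entries are found in memory at the end. The constants hidden in $m^{O(\log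 m)}$, $\operatorname{polylog}(m)$ and $O(\log^2 m)$ are absolute: for one constant $c$, and with $L=\lfloor\log_2 m\rfloor$ ($L=0$ for $m=0$), the bounds are $c\,m^{cL}$, $c\,(L+1)^c$ and $c\,(L+1)^2$ for every $m\ge0$ (with $0^0=1$). -/

import Mathlib

/-! ### A parallel random access machine (PRAM)

All processors run the same program synchronously. Each processor has its own program counter and
its own registers, and all of them share one memory. Every register and every memory cell holds a
word of `b` bits; one step of a processor is one instruction on words. -/

namespace PRAM

/-- Arithmetic operations on words. -/
inductive BinOp where
  | add
  | sub
  | mul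
  | div
  | mod

/-- The value of an operation on natural numbers (truncated subtraction, rounded division). The
machine reduces the result modulo `2 ^ b`. -/
def BinOp.eval : BinOp → ℕ → ℕ → ℕ
  | .add, x, y => x + y
  | .sub, x, y => x - y
  | .mul, x, y => x * y
  | .div, x, y => x / y
  | .mod, x, y => x % y

/-- Instructions; register names, constants and jump targets are fixed numbers in the program. -/
inductive Instr where
  /-- `r := v` -/
  | const (r v : ℕ)
  /-- `r := s op t` -/
  | arith (op : BinOp) (r s t : ℕ)
  /-- `r := memory[s]`, where the register `s` holds the address -/
  | load (r s : ℕ)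
  /-- `memory[s] := r`, where the register `s` holds the address -/
  | store (s r : ℕ)
  /-- continue at instruction `target` -/
  | jump (target : ℕ)
  /-- continue at instruction `target` if the register `r` holds zero -/
  | jumpZero (r target : ℕ)

/-- A program is a finite list of instructions. -/
abbrev Program := List Instr

/-- The private state of one processor. -/
structure Local where
  pc : ℕ
  reg : ℕ → ℕ

/-- A configuration of a machine with `p` processors. -/
structure Config (p : ℕ) where
  proc : Fin p → Local
  mem : ℕ → ℕ

/-- Go to the next instruction after assigning the word `v mod 2 ^ b` to the register `r`. -/
def Local.assign (b : ℕ) (q : Local) (r v : ℕ) : Local :=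
  ⟨q.pc + 1, Function.update q.reg r (v % 2 ^ b)⟩

/-- The effect of one instruction on the private state of a processor that sees memory `mem`. -/
def Instr.exec (b : ℕ) (mem : ℕ → ℕ) (q : Local) : Instr → Local
  | .const r v => q.assign b r v
  | .arith op r s t => q.assign b r (op.eval (q.reg s) (q.reg t))
  | .load r s => q.assign b r (mem (q.reg s))
  | .store _ _ => ⟨q.pc + 1, q.reg⟩
  | .jump target => ⟨target, q.reg⟩
  | .jumpZero r target => if q.reg r = 0 then ⟨target, q.reg⟩ else ⟨q.pc + 1, q.reg⟩

/-- The new private state of a processor. A processor whose program counter points outside the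
program has halted, and nothing changes. -/
def Local.next (prog : Program) (b : ℕ) (mem : ℕ → ℕ) (q : Local) : Local :=
  match prog[q.pc]? with
  | some instr => instr.exec b mem q
  | none => q

/-- The value that a processor writes to the memory cell `a` in this step, if it does so. -/
def Local.write (prog : Program) (q : Local) (a : ℕ) : Option ℕ :=
  match prog[q.pc]? with
  | some (.store s r) => if q.reg s = a then some (q.reg r) else none
  | _ => none

/-- One synchronous step. All processors read the old memory; concurrent reads are allowed, and of
several processors that write to the same cell the one with the smallest number succeeds. -/
def step (prog : Program) (b : ℕ) {p : ℕ} (σ : Config p) : Config p where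
  proc i := (σ.proc i).next prog b σ.mem
  mem a := ((List.finRange p).findSome? fun i => (σ.proc i).write prog a).getD (σ.mem a)

/-- The initial configuration: memory cell `0` holds the input word, register `0` of each processor
holds the number of that processor, all other registers and cells are zero. -/
def init (b p input : ℕ) : Config p where
  proc i := ⟨0, Function.update (fun _ => 0) 0 ((i : ℕ) % 2 ^ b)⟩
  mem := Function.update (fun _ => 0) 0 (input % 2 ^ b)

/-- The configuration after `t` steps. -/
def run (prog : Program) (b p input t : ℕ) : Config p :=
  (step prog b)^[t] (init b p input)

/-- All processors have halted. -/
def Config.Halted (prog : Program) {p : ℕ} (σ : Config p) : Prop :=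
  ∀ i, prog.length ≤ (σ.proc i).pc

/-- The set of vectors in `ℕ ^ m` that is stored in memory: cell `0` holds the number of vectors,
and coordinate `i` of vector `j` is in cell `1 + j * m + i` (both counted from `0`). -/
def Config.output {p : ℕ} (σ : Config p) (m : ℕ) : Finset (Fin m → ℕ) :=
  (Finset.range (σ.mem 0)).image fun j i => σ.mem (1 + j * m + i)

end PRAM

/-- The bound `m ^ O(log m)` with constant `c`. -/
def quasiPolyBound (c m : ℕ) : ℕ := c * m ^ (c * Nat.log 2 m)

/-- The bound `polylog m` with constant `c`. -/
def polylogBound (c m : ℕ) : ℕ := c * (Nat.log 2 m + 1) ^ c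

/-- The word length `O(log² m)` with constant `c`. -/
def wordLength (c m : ℕ) : ℕ := c * (Nat.log 2 m + 1) ^ 2

/-- The fractional linear matroid matching polytope of the lines `l 0, …, l (m - 1)` in `K ^ n`:
all `y ≥ 0` with `∑ i, y i * dim (U ∩ l i) ≤ dim U` for every flat, that is, every linear subspace
`U` of `K ^ n`. -/
def fractionalMatroidMatchingPolytope {K : Type*} [Field K] {n m : ℕ}
    (l : Fin m → Submodule K (Fin n → K)) : Set (Fin m → ℝ) :=
  {y | (∀ i, 0 ≤ y i) ∧ ∀ U : Submodule K (Fin n → K),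
    ∑ i, y i * (Module.finrank K ↥(U ⊓ l i) : ℝ) ≤ (Module.finrank K U : ℝ)}

/-- The weight vector `w` has a unique maximizer over `P`. -/
def IsIsolating {m : ℕ} (w : Fin m → ℕ) (P : Set (Fin m → ℝ)) : Prop :=
  ∃! y, y ∈ P ∧ ∀ z ∈ P, ∑ i, (w i : ℝ) * z i ≤ ∑ i, (w i : ℝ) * y i

/-! Call a vector a flat direction at `y` if it preserves every inequality of the polytope that is
tight at `y`. If `y` is a maximizer at which as few inequalities as possible are tight, the
difference from `y` to any other maximizer is flat, and the objective vanishes on all flat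
directions at `y`. So a weight is isolating once the face of its maximizers has no nonzero flat
direction.

The flat directions have a combinatorial description (`exists_multigraph`). By uncrossing, the tight
subspaces form a lattice on which the intersection dimensions with the lines in the support are
modular, so one maximal chain of tight subspaces determines all tight equations. Along the chain the
dimension of the intersection with a line rises at most twice, by one each time. This makes every
line an edge whose ends are the two places of increase, and the flat directions become the edge
vectors on the support of `y` whose signed sum vanishes at each vertex.

Three facts about such kernels follow from alternating walks and potentials. A nonzero kernel
contains a nonzero integral vector of length at most twice the number of edges
(`exists_short_int_kernel`). The extreme points are half-integral
(`half_integral_of_int_kernel_eq_zero`). If all nonzero integral kernel vectors have length at least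
`r`, only polynomially many have length below `2 * r` (`exists_card_near_shortest_le`).

The weights are built in logarithmically many rounds (`exists_rounds`). In each round a weight `k ^
i % p` with polynomially bounded `p` and `k` is nonzero on all near-shortest vectors
(`exists_power_hash`). It is added to a large multiple of the previous weights, which by
half-integrality only shrinks the face of maximizers. So the near-shortest vectors stop being flat
and the minimal length doubles. Once it exceeds the bound for the shortest vector, no flat direction
is left.

The right `p` and `k` depend on the lines, but all sequences of choices can be tried: there are `m ^
O(log m)` of them. One processor computes one entry of one weight vector by repeated squaring
(`runs_weightCmd`), and all processors need the same number of steps, so they can write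
simultaneously (`exists_run_of_runs`). -/

/-! ### Polyhedra: flat directions, faces of maximizers and perturbed objectives. -/

section Polyhedra

open Matrix

variable {ι : Type*} [Fintype ι]

/-- The set of solutions of a system of linear inequalities. -/
def polyhedron (C : Set ((ι → ℝ) × ℝ)) : Set (ι → ℝ) :=
  {y | ∀ c ∈ C, c.1 ⬝ᵥ y ≤ c.2}

/-- The direction `x` preserves all inequalities that are tight at `y`. -/
def IsFlatDirection (C : Set ((ι → ℝ) × ℝ)) (y x : ι → ℝ) : Prop :=
  ∀ c ∈ C, c.1 ⬝ᵥ y = c.2 → c.1 ⬝ᵥ x = 0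

/-- The points of `P` that maximize the linear function with coefficients `w`. -/
def maxFace (w : ι → ℝ) (P : Set (ι → ℝ)) : Set (ι → ℝ) :=
  {y | y ∈ P ∧ ∀ z ∈ P, w ⬝ᵥ z ≤ w ⬝ᵥ y}

theorem IsFlatDirection.neg {C : Set ((ι → ℝ) × ℝ)} {y x : ι → ℝ} (h : IsFlatDirection C y x) :
    IsFlatDirection C y (-x) := fun c hc hy => by
  rw [dotProduct_neg, h c hc hy, neg_zero]

/-- Tight inequalities stay equalities along `x`, and each of the finitely many slack ones survives
a small step. -/
theorem IsFlatDirection.exists_pos_add_smul_mem {C : Set ((ι → ℝ) × ℝ)} (hC : C.Finite)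
    {y x : ι → ℝ} (hy : y ∈ polyhedron C) (hx : IsFlatDirection C y x) :
    ∃ ε > (0 : ℝ), y + ε • x ∈ polyhedron C := by
  have key : ∀ c ∈ C, ∀ᶠ ε in nhdsWithin (0 : ℝ) (Set.Ioi 0), c.1 ⬝ᵥ (y + ε • x) ≤ c.2 := by
    intro c hc
    by_cases h : c.1 ⬝ᵥ y = c.2
    · refine Filter.Eventually.of_forall fun ε => ?_
      rw [dotProduct_add, dotProduct_smul, hx c hc h, h]
      simp
    · have hlt : c.1 ⬝ᵥ y < c.2 := lt_of_le_of_ne (hy c hc) h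
      have hcont : Filter.Tendsto (fun ε : ℝ => c.1 ⬝ᵥ y + ε * (c.1 ⬝ᵥ x))
          (nhdsWithin (0 : ℝ) (Set.Ioi 0)) (nhds (c.1 ⬝ᵥ y + 0 * (c.1 ⬝ᵥ x))) := by
        refine Filter.Tendsto.mono_left (Continuous.tendsto ?_ 0) nhdsWithin_le_nhds
        fun_prop
      rw [zero_mul, add_zero] at hcont
      filter_upwards [hcont.eventually_lt_const hlt] with ε hε
      rw [dotProduct_add, dotProduct_smul, smul_eq_mul]
      exact hε.le
  have hall : ∀ᶠ ε in nhdsWithin (0 : ℝ) (Set.Ioi 0), ∀ c ∈ C, c.1 ⬝ᵥ (y + ε • x) ≤ c.2 :=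
    (Filter.eventually_all_finite hC).2 key
  obtain ⟨ε, hε, hpos⟩ := (hall.and self_mem_nhdsWithin).exists
  exact ⟨ε, hpos, hε⟩

/-- Both `x` and `-x` are feasible directions at a maximizer, so neither increases the objective. -/
theorem IsFlatDirection.dotProduct_eq_zero {C : Set ((ι → ℝ) × ℝ)} (hC : C.Finite)
    {w y x : ι → ℝ} (hy : y ∈ maxFace w (polyhedron C)) (hx : IsFlatDirection C y x) :
    w ⬝ᵥ x = 0 := by
  have key : ∀ z, IsFlatDirection C y z → w ⬝ᵥ z ≤ 0 := by
    intro z hz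
    obtain ⟨ε, hε, hmem⟩ := hz.exists_pos_add_smul_mem hC hy.1
    have := hy.2 _ hmem
    rw [dotProduct_add, dotProduct_smul, smul_eq_mul] at this
    nlinarith
  have h1 := key x hx
  have h2 := key (-x) hx.neg
  rw [dotProduct_neg] at h2
  linarith

theorem IsFlatDirection.eq_zero_of_mem_extremePoints {C : Set ((ι → ℝ) × ℝ)} (hC : C.Finite)
    {y x : ι → ℝ} (hy : y ∈ (polyhedron C).extremePoints ℝ) (hx : IsFlatDirection C y x) :
    x = 0 := by
  obtain ⟨ε, hε, h1⟩ := hx.exists_pos_add_smul_mem hC hy.1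
  obtain ⟨δ, hδ, h2⟩ := hx.neg.exists_pos_add_smul_mem hC hy.1
  have hseg : y ∈ openSegment ℝ (y + ε • x) (y + δ • -x) := by
    refine ⟨δ / (ε + δ), ε / (ε + δ), by positivity, by positivity, by field_simp; ring, ?_⟩
    ext i
    simp only [Pi.add_apply, Pi.smul_apply, smul_eq_mul, Pi.neg_apply]
    field_simp
    ring
  have h3 := (mem_extremePoints.1 hy).2 _ h1 _ h2 hseg
  have h4 : ε • x = 0 := by simpa using h3.1
  exact (smul_eq_zero.1 h4).resolve_left hε.ne'

/-- This replaces a relative interior point. A point with the fewest tight inequalities works: its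
midpoint with `z` is tight only where both are, so by minimality `z` is tight wherever `y` is. -/
theorem exists_tight_minimal {C : Set ((ι → ℝ) × ℝ)} (hC : C.Finite) {F : Set (ι → ℝ)}
    (hF : Convex ℝ F) (hne : F.Nonempty) (hsub : F ⊆ polyhedron C) :
    ∃ y ∈ F, ∀ z ∈ F, ∀ c ∈ C, c.1 ⬝ᵥ y = c.2 → c.1 ⬝ᵥ z = c.2 := by
  let T : (ι → ℝ) → Set ((ι → ℝ) × ℝ) := fun y => {c ∈ C | c.1 ⬝ᵥ y = c.2}
  obtain ⟨y, hy, hmin⟩ : ∃ y ∈ F, ∀ z ∈ F, (T y).ncard ≤ (T z).ncard := by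
    exact ⟨Function.argminOn (fun z => (T z).ncard) F hne, Function.argminOn_mem _ _ _,
      fun z hz => Function.argminOn_le (fun z => (T z).ncard) F hz⟩
  refine ⟨y, hy, fun z hz c hc hyc => ?_⟩
  let u : ι → ℝ := (1 / 2 : ℝ) • y + (1 / 2 : ℝ) • z
  have hu : u ∈ F := hF hy hz (by norm_num) (by norm_num) (by norm_num)
  have hu' : ∀ d : (ι → ℝ) × ℝ, d.1 ⬝ᵥ u = (d.1 ⬝ᵥ y + d.1 ⬝ᵥ z) / 2 := by
    intro d
    simp only [u, dotProduct_add, dotProduct_smul, smul_eq_mul]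
    ring
  have hTu : T u ⊆ T y := by
    rintro d ⟨hd, hdu⟩
    refine ⟨hd, ?_⟩
    have h1 := hsub hy d hd
    have h2 := hsub hz d hd
    rw [hu'] at hdu
    linarith
  have heq : T u = T y := Set.eq_of_subset_of_ncard_le hTu (hmin u hu) (hC.subset fun d hd => hd.1)
  have hcu : c ∈ T u := heq ▸ ⟨hc, hyc⟩
  have := hcu.2
  rw [hu'] at this
  linarith

theorem convex_polyhedron (C : Set ((ι → ℝ) × ℝ)) : Convex ℝ (polyhedron C) := by
  intro x hx y hy a b ha hb hab c hc
  rw [dotProduct_add, dotProduct_smul, dotProduct_smul, smul_eq_mul, smul_eq_mul]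
  have h1 := mul_le_mul_of_nonneg_left (hx c hc) ha
  have h2 := mul_le_mul_of_nonneg_left (hy c hc) hb
  have h3 : a * c.2 + b * c.2 = c.2 := by rw [← add_mul, hab, one_mul]
  linarith

theorem isClosed_polyhedron (C : Set ((ι → ℝ) × ℝ)) : IsClosed (polyhedron C) := by
  have : polyhedron C = ⋂ c ∈ C, {y | c.1 ⬝ᵥ y ≤ c.2} := by
    ext y
    simp [polyhedron]
  rw [this]
  refine isClosed_biInter fun c _ => isClosed_le ?_ continuous_const
  unfold dotProduct
  fun_prop

theorem isExposed_maxFace (w : ι → ℝ) (P : Set (ι → ℝ)) : IsExposed ℝ P (maxFace w P) := by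
  intro _
  let f : (ι → ℝ) →ₗ[ℝ] ℝ :=
    { toFun := fun y => w ⬝ᵥ y
      map_add' := dotProduct_add w
      map_smul' := fun c y => dotProduct_smul c w y }
  exact ⟨LinearMap.toContinuousLinearMap f, rfl⟩

theorem maxFace_nonempty {P : Set (ι → ℝ)} (hP : IsCompact P) (hne : P.Nonempty) (w : ι → ℝ) :
    (maxFace w P).Nonempty := by
  have hcont : Continuous fun y : ι → ℝ => w ⬝ᵥ y := by
    unfold dotProduct
    fun_prop
  obtain ⟨y, hy, hmax⟩ := hP.exists_isMaxOn hne hcont.continuousOn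
  exact ⟨y, hy, fun z hz => hmax hz⟩

/-- If the extreme points of a compact set have half-integral coordinates, then adding a small
perturbation to a large multiple of an integral objective refines the set of maximizers. -/
theorem maxFace_subset_of_half_integral {P : Set (ι → ℝ)} (hP : IsCompact P) (hne : P.Nonempty)
    (hP01 : ∀ y ∈ P, ∀ i, 0 ≤ y i ∧ y i ≤ 1)
    (hhalf : ∀ y ∈ P.extremePoints ℝ, ∀ i, ∃ k : ℤ, 2 * y i = k) {W w : ι → ℕ} {B c : ℕ}
    (hw : ∀ i, w i ≤ c) (hB : 2 * (Fintype.card ι * c) < B) :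
    maxFace (fun i => (W i : ℝ) * B + w i) P ⊆ maxFace (fun i => (W i : ℝ)) P := by
  intro y hy
  refine ⟨hy.1, fun z hz => ?_⟩
  by_contra hlt
  push Not at hlt
  set W' : ι → ℝ := fun i => (W i : ℝ) with hW'
  set w' : ι → ℝ := fun i => (w i : ℝ) with hw'
  set G : ι → ℝ := fun i => (W i : ℝ) * B + w i with hG
  have hGdot : ∀ u : ι → ℝ, G ⬝ᵥ u = B * (W' ⬝ᵥ u) + w' ⬝ᵥ u := by
    intro u
    simp only [dotProduct, hG, hW', hw', Finset.mul_sum, ← Finset.sum_add_distrib]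
    exact Finset.sum_congr rfl fun i _ => by ring
  have hint : ∀ u ∈ P.extremePoints ℝ, ∃ k : ℤ, 2 * (W' ⬝ᵥ u) = k := by
    intro u hu
    choose k hk using hhalf u hu
    refine ⟨∑ i, (W i : ℤ) * k i, ?_⟩
    push_cast
    simp only [dotProduct, hW', Finset.mul_sum]
    exact Finset.sum_congr rfl fun i _ => by rw [← hk]; ring
  have hFG := isExposed_maxFace G P
  have hFGc := hFG.isCompact hP
  -- Among the maximizers of the perturbed objective, those of least `W'`-value form a face. An
  -- extreme point `u` of it is half-integral and no better for `W'` than `y`.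
  have hFm := isExposed_maxFace (-W') (maxFace G P)
  have hne1 : (maxFace (-W') (maxFace G P)).Nonempty := maxFace_nonempty hFGc ⟨y, hy⟩ _
  obtain ⟨u, hu⟩ := (hFm.isCompact hFGc).extremePoints_nonempty hne1
  have hu1 : u ∈ maxFace (-W') (maxFace G P) := hu.1
  have huP : u ∈ P.extremePoints ℝ :=
    (hFG.isExtreme.trans hFm.isExtreme).extremePoints_subset_extremePoints hu
  have hFW := isExposed_maxFace W' P
  obtain ⟨v, hv⟩ := (hFW.isCompact hP).extremePoints_nonempty (maxFace_nonempty hP hne _)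
  have hv1 : v ∈ maxFace W' P := hv.1
  have hvP : v ∈ P.extremePoints ℝ := hFW.isExtreme.extremePoints_subset_extremePoints hv
  obtain ⟨k, hk⟩ := hint u huP
  obtain ⟨k', hk'⟩ := hint v hvP
  have h1 : W' ⬝ᵥ u ≤ W' ⬝ᵥ y := by
    have := hu1.2 y hy
    rw [neg_dotProduct, neg_dotProduct] at this
    linarith
  have h2 := hv1.2 z hz
  have hkk : k < k' := by
    have : (k : ℝ) < k' := by rw [← hk, ← hk']; linarith
    exact_mod_cast this
  have hkk' : (k : ℝ) + 1 ≤ k' := by exact_mod_cast hkk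
  have h3 := hu1.1.2 v hv1.1
  rw [hGdot, hGdot] at h3
  have h4 : 0 ≤ w' ⬝ᵥ v :=
    Finset.sum_nonneg fun i _ => mul_nonneg (Nat.cast_nonneg _) (hP01 v hv1.1 i).1
  have h5 : w' ⬝ᵥ u ≤ Fintype.card ι * c := by
    have : w' ⬝ᵥ u ≤ ∑ _i : ι, (c : ℝ) := by
      refine Finset.sum_le_sum fun i _ => ?_
      have ha : w' i ≤ c := Nat.cast_le.2 (hw i)
      have hb := hP01 u huP.1 i
      have hc0 : (0 : ℝ) ≤ w' i := Nat.cast_nonneg _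
      nlinarith
    simpa using this
  have h6 : 2 * ((Fintype.card ι : ℝ) * c) < B := by exact_mod_cast hB
  -- Two distinct half-integral values differ by at least `1 / 2`. Multiplied by `B`, this outweighs
  -- anything that `w'` can contribute.
  have h7 : (1 : ℝ) / 2 ≤ W' ⬝ᵥ v - W' ⬝ᵥ u := by linarith
  have h8 : (B : ℝ) * (1 / 2) ≤ B * (W' ⬝ᵥ v - W' ⬝ᵥ u) :=
    mul_le_mul_of_nonneg_left h7 (Nat.cast_nonneg _)
  nlinarith

end Polyhedra
-- Multigraphs: short kernel vectors of the boundary and half-integrality.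
section MultigraphBoundary

open Finset

variable {E V : Type*} [Fintype E] [DecidableEq V]

/-- The multigraph with edges `E` and endpoints `a e`, `b e`: the sum of the values of `x` over the
edges at the vertex `u`, where loops count twice. -/
def boundary {R : Type*} [Ring R] (a b : E → V) (x : E → R) (u : V) : R :=
  ∑ e, x e * ((Pi.single (a e) 1 : V → R) u + (Pi.single (b e) 1 : V → R) u)

section Ring
variable {R : Type*} [Ring R] (a b : E → V)

theorem boundary_add (x y : E → R) : boundary a b (x + y) = boundary a b x + boundary a b y := by
  ext u
  simp [boundary, add_mul, sum_add_distrib]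

theorem boundary_sub (x y : E → R) : boundary a b (x - y) = boundary a b x - boundary a b y := by
  ext u
  simp [boundary, sub_mul, sum_sub_distrib]

theorem boundary_zero : boundary a b (0 : E → R) = 0 := by
  ext u
  simp [boundary]

theorem boundary_neg (x : E → R) :
    boundary a b (-x) = -boundary a b x := by
  ext u
  simp [boundary]

end Ring

/-- The source of an oriented edge. -/
def dartSrc (a b : E → V) (h : E × Bool) : V := if h.2 then a h.1 else b h.1

/-- The target of an oriented edge. -/
def dartTgt (a b : E → V) (h : E × Bool) : V := if h.2 then b h.1 else a h.1

/-- If the boundary is positive at a vertex, some edge at that vertex has a positive value. -/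
theorem exists_dart_pos {R : Type*} [Ring R] [LinearOrder R] [IsStrictOrderedRing R]
    (a b : E → V) {x : E → R} {u : V} (h : 0 < boundary a b x u) :
    ∃ d : E × Bool, dartSrc a b d = u ∧ 0 < x d.1 := by
  obtain ⟨e, -, he⟩ := exists_lt_of_sum_lt (s := univ) (f := fun _ : E => (0 : R))
    (by simpa [boundary] using h)
  by_cases ha : a e = u
  · refine ⟨(e, true), ha, ?_⟩
    by_contra hx
    have h2 : 0 ≤ (Pi.single (a e) 1 : V → R) u + (Pi.single (b e) 1 : V → R) u := by
      simp only [Pi.single_apply]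
      split_ifs <;> norm_num
    exact absurd he (not_lt.2 (mul_nonpos_of_nonpos_of_nonneg (not_lt.1 hx) h2))
  · by_cases hb : b e = u
    · refine ⟨(e, false), hb, ?_⟩
      have h1 : (Pi.single (a e) (1 : R) : V → R) u = 0 := Pi.single_eq_of_ne (Ne.symm ha) _
      have h2 : (Pi.single (b e) (1 : R) : V → R) u = 1 := by rw [hb, Pi.single_eq_same]
      simpa [h1, h2] using he
    · have h1 : (Pi.single (a e) (1 : R) : V → R) u = 0 := Pi.single_eq_of_ne (Ne.symm ha) _
      have h2 : (Pi.single (b e) (1 : R) : V → R) u = 0 := Pi.single_eq_of_ne (Ne.symm hb) _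
      simp [h1, h2] at he

variable [DecidableEq E]

theorem boundary_single {R : Type*} [Ring R] (a b : E → V) (e : E) (r : R) :
    boundary a b (Pi.single e r) = Pi.single (a e) r + Pi.single (b e) r := by
  ext u
  rw [boundary, sum_eq_single e]
  · simp [Pi.single_apply, mul_add]
  · intro f _ hf
    simp [hf]
  · simp

theorem boundary_single_dart {R : Type*} [Ring R] (a b : E → V) (h : E × Bool) (r : R) :
    boundary a b (Pi.single h.1 r) =
      Pi.single (dartSrc a b h) r + Pi.single (dartTgt a b h) r := by
  rw [boundary_single]
  rcases h with ⟨e, _ | _⟩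
  · simp [dartSrc, dartTgt, add_comm]
  · simp [dartSrc, dartTgt]

/-- In the kernel of the boundary, an edge with a positive value continues, at each of its ends,
with an edge with a negative value. -/
theorem exists_dart_neg {R : Type*} [Ring R] [LinearOrder R] [IsStrictOrderedRing R]
    (a b : E → V) {x : E → R} (hx : boundary a b x = 0) (d : E × Bool) (hd : 0 < x d.1) :
    ∃ d' : E × Bool, dartSrc a b d' = dartTgt a b d ∧ x d'.1 < 0 := by
  set u := dartTgt a b d with hu
  -- The vector `-x` with its entry at `d.1` erased has positive boundary at `u`. Hence a positive
  -- entry of it at `u` belongs to an edge other than `d.1`, where `x` is negative.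
  have h0 : boundary a b (-x + Pi.single d.1 (x d.1)) u = boundary a b (Pi.single d.1 (x d.1)) u := by
    rw [boundary_add, boundary_neg, hx, neg_zero, zero_add]
  have hpos : 0 < boundary a b (-x + Pi.single d.1 (x d.1)) u := by
    rw [h0, boundary_single_dart, Pi.add_apply, ← hu, Pi.single_eq_same, Pi.single_apply]
    split_ifs
    · exact add_pos hd hd
    · simpa using hd
  obtain ⟨d', h1, h2⟩ := exists_dart_pos a b hpos
  refine ⟨d', h1, ?_⟩
  by_cases h : d'.1 = d.1
  · simp [h] at h2
  · simpa [h] using h2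

/-- A nonzero real vector in the kernel of the boundary yields a short integral one. -/
theorem exists_short_int_kernel (a b : E → V) {x : E → ℝ} (hx : boundary a b x = 0) (hne : x ≠ 0) :
    ∃ v : E → ℤ, v ≠ 0 ∧ boundary a b v = 0 ∧ (∀ e, x e = 0 → v e = 0) ∧
      ∑ e, |v e| ≤ 2 * Fintype.card E := by
  -- The walk follows a fixed successor function on oriented edges, alternating between positive and
  -- negative entries of `x`.
  have hstep : ∀ d : E × Bool, ∃ d' : E × Bool, x d.1 ≠ 0 →
      dartSrc a b d' = dartTgt a b d ∧ SignType.sign (x d'.1) = -SignType.sign (x d.1) := by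
    intro d
    rcases lt_trichotomy (x d.1) 0 with h | h | h
    · have hx' : boundary a b (-x) = 0 := by rw [boundary_neg, hx, neg_zero]
      obtain ⟨d', h1, h2⟩ := exists_dart_neg a b hx' d (by simpa using h)
      refine ⟨d', fun _ => ⟨h1, ?_⟩⟩
      rw [sign_neg h, sign_pos (by simpa using h2), neg_neg]
    · exact ⟨d, fun h' => absurd h h'⟩
    · obtain ⟨d', h1, h2⟩ := exists_dart_neg a b hx d h
      refine ⟨d', fun _ => ⟨h1, ?_⟩⟩
      rw [sign_pos h, sign_neg h2]
  choose f hf using hstep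
  obtain ⟨e₀, he₀⟩ := Function.ne_iff.1 hne
  let w : ℕ → E × Bool := fun n => f^[n] (e₀, true)
  have hw : ∀ n, w (n + 1) = f (w n) := fun n => Function.iterate_succ_apply' _ _ _
  have hw0 : ∀ n, x (w n).1 ≠ 0 := by
    intro n
    induction n with
    | zero => exact he₀
    | succ n ih =>
      rw [hw]
      have := (hf _ ih).2
      intro h0
      rw [h0, sign_zero] at this
      rcases lt_or_gt_of_ne ih with h | h
      · simp [sign_neg h] at this
      · simp [sign_pos h] at this
  let g : ℕ → ℤ := fun n => (SignType.sign (x (w n).1) : ℤ)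
  have hg : ∀ n, g (n + 1) = -g n := by
    intro n
    simp only [g]
    rw [hw, (hf _ (hw0 n)).2]
    simp
  have hsrc : ∀ n, dartSrc a b (w (n + 1)) = dartTgt a b (w n) := fun n => by
    rw [hw, (hf _ (hw0 n)).1]
  -- There are only `2 * Fintype.card E` oriented edges, so one recurs. The sign of `x` on it is the
  -- same both times, which makes the closed walk alternate consistently.
  obtain ⟨i, j, hij, hle, hwij⟩ : ∃ i j, i < j ∧ j ≤ 2 * Fintype.card E ∧ w i = w j := by
    obtain ⟨i, j, hne, heq⟩ := Fintype.exists_ne_map_eq_of_card_lt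
      (fun n : Fin (2 * Fintype.card E + 1) => w n) (by simp [mul_comm])
    rcases lt_or_gt_of_ne hne with h | h
    · exact ⟨i, j, h, by omega, heq⟩
    · exact ⟨j, i, h, by omega, heq.symm⟩
  let v : ℕ → E → ℤ := fun n => ∑ k ∈ range n, Pi.single (w (i + k)).1 (g (i + k))
  have hv : ∀ n, v (n + 1) = v n + Pi.single (w (i + n)).1 (g (i + n)) := fun n =>
    sum_range_succ _ _
  have hbd : ∀ n, boundary a b (v n) =
      Pi.single (dartSrc a b (w i)) (g i) - Pi.single (dartSrc a b (w (i + n))) (g (i + n)) := by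
    intro n
    induction n with
    | zero => simp [v, boundary_zero]
    | succ n ih =>
      rw [hv, boundary_add, ih, boundary_single_dart, ← add_assoc i, hsrc, hg, Pi.single_neg]
      abel
  have habs : ∀ n, ∑ e, |v n e| ≤ n := by
    intro n
    induction n with
    | zero => simp [v]
    | succ n ih =>
      have h1 : ∑ e, |(Pi.single (w (i + n)).1 (g (i + n)) : E → ℤ) e| ≤ 1 := by
        rw [sum_eq_single (w (i + n)).1]
        · simp only [Pi.single_eq_same, g]
          cases SignType.sign (x (w (i + n)).1) <;> simp
        · intro e _ he
          simp [he]
        · simp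
      calc ∑ e, |v (n + 1) e| ≤ ∑ e, (|v n e| + |(Pi.single (w (i + n)).1 (g (i + n)) : E → ℤ) e|) :=
            sum_le_sum fun e _ => by rw [hv]; exact abs_add_le _ _
        _ ≤ n + 1 := by rw [sum_add_distrib]; exact add_le_add ih h1
        _ = _ := by push_cast; rfl
  -- Every edge is added with the sign that `x` has there, so nothing cancels and the sum along the
  -- closed walk is nonzero.
  have hconf : ∀ n e, 0 ≤ v n e * (SignType.sign (x e) : ℤ) := by
    intro n e
    induction n with
    | zero => simp [v]
    | succ n ih =>
      rw [hv, Pi.add_apply, add_mul]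
      refine add_nonneg ih ?_
      by_cases h : e = (w (i + n)).1
      · subst h
        rw [Pi.single_eq_same]
        exact mul_self_nonneg _
      · simp [h]
  have hpos : ∀ n, 0 < v (n + 1) (w i).1 * g i := by
    intro n
    induction n with
    | zero =>
      have : g i ≠ 0 := by
        simp only [g]
        have := hw0 i
        rcases lt_or_gt_of_ne this with h | h
        · simp [sign_neg h]
        · simp [sign_pos h]
      simp [v, mul_self_pos.2 this]
    | succ n ih =>
      rw [hv, Pi.add_apply, add_mul]
      refine add_pos_of_pos_of_nonneg ih ?_
      by_cases h : (w i).1 = (w (i + (n + 1))).1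
      · rw [← h, Pi.single_eq_same]
        simp only [g]
        rw [← h]
        exact mul_self_nonneg _
      · simp [h]
  have hsupp : ∀ n e, x e = 0 → v n e = 0 := by
    intro n e he
    simp only [v, Finset.sum_apply]
    refine sum_eq_zero fun k _ => Pi.single_eq_of_ne ?_ _
    rintro rfl
    exact hw0 _ he
  refine ⟨v (j - i), ?_, ?_, hsupp _, (habs _).trans (by omega)⟩
  · obtain ⟨n, hn⟩ : ∃ n, j - i = n + 1 := ⟨j - i - 1, by omega⟩
    intro h
    have := hpos n
    rw [← hn, h] at this
    simp at this
  · rw [hbd, show i + (j - i) = j by omega]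
    have : g j = g i := by simp only [g, hwij]
    rw [this, hwij, sub_self]

/-- If no nonzero integral vector supported in `S` has boundary zero, then every real vector
supported in `S` with integral boundary is half-integral. -/
theorem half_integral_of_int_kernel_eq_zero (a b : E → V) {S : Set E}
    (hS : ∀ v : E → ℤ, (∀ e ∉ S, v e = 0) → boundary a b v = 0 → v = 0)
    {y : E → ℝ} (hy : ∀ e ∉ S, y e = 0) (hyb : ∀ u, ∃ k : ℤ, boundary a b y u = k) (e : E) :
    ∃ k : ℤ, 2 * y e = k := by
  classical
  by_cases he : e ∈ S
  swap
  · exact ⟨0, by simp [hy e he]⟩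
  -- a potential `c` on the touched vertices that sums to zero along all other edges gives the claim
  have pot : ∀ c : V → ℤ, (∀ f ∈ S, f ≠ e → c (a f) + c (b f) = 0) →
      ∃ k : ℤ, y e * (c (a e) + c (b e)) = k := by
    intro c hc
    let T : Finset V := univ.image a ∪ univ.image b
    choose k hk using hyb
    refine ⟨∑ u ∈ T, c u * k u, ?_⟩
    push_cast
    simp only [← hk, boundary, mul_sum]
    rw [sum_comm, sum_eq_single e]
    · have ha : a e ∈ T := mem_union_left _ (mem_image_of_mem _ (mem_univ _))
      have hb : b e ∈ T := mem_union_right _ (mem_image_of_mem _ (mem_univ _))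
      simp only [mul_add, sum_add_distrib, Pi.single_apply, mul_ite, mul_one, mul_zero,
        Finset.sum_ite_eq', ha, hb, if_true]
      ring
    · intro f _ hf
      by_cases hfS : f ∈ S
      · have ha : a f ∈ T := mem_union_left _ (mem_image_of_mem _ (mem_univ _))
        have hb : b f ∈ T := mem_union_right _ (mem_image_of_mem _ (mem_univ _))
        simp only [mul_add, sum_add_distrib, Pi.single_apply, mul_ite, mul_one, mul_zero,
          Finset.sum_ite_eq', ha, hb, if_true]
        have : (c (a f) : ℝ) + c (b f) = 0 := by exact_mod_cast hc f hfS hf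
        linear_combination y f * this
      · simp [hy f hfS]
    · simp
  -- The integral vectors supported in `S` without `e`.
  let Z : (E → ℤ) → Prop := fun z => ∀ f, f ∉ S ∨ f = e → z f = 0
  have hsingle : ∀ f ∈ S, f ≠ e → ∀ r, Z (Pi.single f r) := by
    intro f hf hfe r f' hf'
    refine Pi.single_eq_of_ne ?_ _
    rintro rfl
    exact hf'.elim (fun h => h hf) hfe
  have hZadd : ∀ z z', Z z → Z z' → Z (z + z') := fun z z' h h' f hf => by
    rw [Pi.add_apply, h f hf, h' f hf, add_zero]
  have hZsub : ∀ z z', Z z → Z z' → Z (z - z') := fun z z' h h' f hf => by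
    rw [Pi.sub_apply, h f hf, h' f hf, sub_zero]
  -- no vector that avoids `e` has the same boundary as a nonzero multiple of `e`
  have hker : ∀ z r, Z z → r ≠ 0 → boundary a b z ≠ boundary a b (Pi.single e r) := by
    intro z r hz hr hzr
    have h0 : z - Pi.single e r = 0 := by
      refine hS _ (fun f hf => ?_) (by rw [boundary_sub, hzr, sub_self])
      have hfe : f ≠ e := fun h => hf (h ▸ he)
      simp [hz f (Or.inl hf), hfe]
    have := congr_fun h0 e
    simp [hz e (Or.inr rfl), hr] at this
  -- the claim holds if `2 * p` is not a boundary for an end `p` of `e`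
  have main : ∀ p q : V, (∀ c : V → ℤ, c (a e) + c (b e) = c p + c q) →
      boundary a b (Pi.single e (1 : ℤ)) = Pi.single p 1 + Pi.single q 1 →
      (∀ z, Z z → boundary a b z ≠ Pi.single p 2) → ∃ k : ℤ, 2 * y e = k := by
    intro p q hpq hbe hp
    -- These are the vertices that alternating walks avoiding `e` connect to `p` with an even or odd
    -- number of edges. If `2 * p` is not a boundary, the classes are disjoint, and the potential
    -- `1` on `ev`, `-1` on `od` cancels along all edges of `S` but `e`.
    let ev : V → Prop := fun u => ∃ z, Z z ∧ boundary a b z = Pi.single u 1 - Pi.single p 1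
    let od : V → Prop := fun u => ∃ z, Z z ∧ boundary a b z = Pi.single u 1 + Pi.single p 1
    have hexcl : ∀ u, ev u → ¬ od u := by
      rintro u ⟨z, hz, hzb⟩ ⟨z', hz', hzb'⟩
      refine hp (z' - z) (hZsub _ _ hz' hz) ?_
      rw [boundary_sub, hzb, hzb', show (2 : ℤ) = 1 + 1 from rfl, Pi.single_add]
      abel
    have hevod : ∀ f ∈ S, f ≠ e → (ev (a f) → od (b f)) ∧ (ev (b f) → od (a f)) := by
      refine fun f hf hfe => ⟨?_, ?_⟩ <;> rintro ⟨z, hz, hzb⟩ <;>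
        refine ⟨Pi.single f 1 - z, hZsub _ _ (hsingle f hf hfe 1) hz, ?_⟩ <;>
        rw [boundary_sub, boundary_single, hzb] <;> abel
    have hodev : ∀ f ∈ S, f ≠ e → (od (a f) → ev (b f)) ∧ (od (b f) → ev (a f)) := by
      refine fun f hf hfe => ⟨?_, ?_⟩ <;> rintro ⟨z, hz, hzb⟩ <;>
        refine ⟨Pi.single f 1 - z, hZsub _ _ (hsingle f hf hfe 1) hz, ?_⟩ <;>
        rw [boundary_sub, boundary_single, hzb] <;> abel
    let c : V → ℤ := fun u => if ev u then 1 else if od u then -1 else 0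
    have hc : ∀ f ∈ S, f ≠ e → c (a f) + c (b f) = 0 := by
      intro f hf hfe
      have h1 := hevod f hf hfe
      have h2 := hodev f hf hfe
      have h3 := hexcl (a f)
      have h4 := hexcl (b f)
      simp only [c]
      by_cases ha : ev (a f)
      · have := h1.1 ha
        have hb : ¬ ev (b f) := fun h => h4 h this
        simp [ha, hb, this]
      · by_cases ha' : od (a f)
        · have := h2.1 ha'
          simp [ha, ha', this]
        · have hb : ¬ ev (b f) := fun h => ha' (h1.2 h)
          have hb' : ¬ od (b f) := fun h => ha (h2.2 h)
          simp [ha, ha', hb, hb']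
    have hcp : c p = 1 := by
      have : ev p := ⟨0, fun _ _ => rfl, by rw [boundary_zero, sub_self]⟩
      simp [c, this]
    -- Otherwise a vector avoiding `e` would have the boundary of `e`. So the potential of `q` is
    -- `0` or `1`, and `y e` or `2 * y e` is an integer.
    have hoq : ¬ od q := by
      rintro ⟨z, hz, hzb⟩
      exact hker z 1 hz one_ne_zero (by rw [hzb, hbe, add_comm])
    obtain ⟨k, hk⟩ := pot c hc
    have hpq' : (c (a e) : ℝ) + c (b e) = c p + c q := by exact_mod_cast hpq c
    rw [hpq', hcp] at hk
    by_cases hq : ev q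
    · have : c q = 1 := by simp [c, hq]
      rw [this] at hk
      push_cast at hk
      exact ⟨k, by linarith⟩
    · have : c q = 0 := by simp [c, hq, hoq]
      rw [this] at hk
      push_cast at hk
      exact ⟨2 * k, by push_cast; linarith⟩
  by_cases hp : ∀ z, Z z → boundary a b z ≠ Pi.single (a e) 2
  · exact main (a e) (b e) (fun _ => rfl) (boundary_single a b e 1) hp
  by_cases hq : ∀ z, Z z → boundary a b z ≠ Pi.single (b e) 2
  · exact main (b e) (a e) (fun _ => add_comm _ _)
      ((boundary_single a b e 1).trans (add_comm _ _)) hq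
  -- If both `2 * a e` and `2 * b e` are boundaries of vectors avoiding `e`, their sum is the
  -- boundary of twice the edge `e`, which the trivial kernel forbids.
  push Not at hp hq
  obtain ⟨z, hz, hzb⟩ := hp
  obtain ⟨z', hz', hzb'⟩ := hq
  exact absurd (by rw [boundary_add, hzb, hzb', boundary_single])
    (hker (z + z') 2 (hZadd _ _ hz hz') two_ne_zero)

end MultigraphBoundary
-- Counting near-shortest integral kernel vectors.
section NearShortest

open Finset

theorem exists_dart_tgt {E V : Type*} (a b : E → V) (d : E × Bool) :
    ∃ d' : E × Bool, dartSrc a b d' = dartTgt a b d :=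
  ⟨(d.1, !d.2), by rcases d with ⟨e, _ | _⟩ <;> rfl⟩

variable {E V : Type*} [Fintype E] [DecidableEq V]

theorem exists_chain_of_step {α : Type*} {P : ℕ → α → Prop} {Q : α → α → Prop} {l : ℕ} {x₀ : α}
    (h0 : P 0 x₀) (hstep : ∀ n < l, ∀ x, P n x → ∃ x', P (n + 1) x' ∧ Q x x') :
    ∃ f : ℕ → α, f 0 = x₀ ∧ (∀ n ≤ l, P n (f n)) ∧ ∀ n < l, Q (f n) (f (n + 1)) := by
  have h : ∀ n x, ∃ x', n < l → P n x → P (n + 1) x' ∧ Q x x' := by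
    intro n x
    by_cases hn : n < l
    · by_cases hx : P n x
      · obtain ⟨x', h'⟩ := hstep n hn x hx
        exact ⟨x', fun _ _ => h'⟩
      · exact ⟨x, fun _ h' => absurd h' hx⟩
    · exact ⟨x, fun h' => absurd h' hn⟩
  choose g hg using h
  let f : ℕ → α := fun n => Nat.rec x₀ g n
  have hP : ∀ n ≤ l, P n (f n) := by
    intro n
    induction n with
    | zero => exact fun _ => h0
    | succ n ih => exact fun hn => (hg n (f n) hn (ih (by omega))).1
  exact ⟨f, rfl, hP, fun n hn => (hg n (f n) hn (hP n hn.le)).2⟩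

open Classical in
/-- The possible boundaries of an alternating walk. -/
noncomputable def walkBoundaries (a b : E → V) : Finset (V → ℤ) :=
  univ.image fun p : ((E × Bool) × Bool) × ((E × Bool) × Bool) =>
    Pi.single (dartSrc a b p.1.1) (if p.1.2 then 1 else -1) +
      Pi.single (dartSrc a b p.2.1) (if p.2.2 then 1 else -1)

theorem mem_walkBoundaries (a b : E → V) {s t : ℤ} (hs : s = 1 ∨ s = -1) (ht : t = 1 ∨ t = -1)
    (d d' : E × Bool) :
    Pi.single (dartSrc a b d) s + Pi.single (dartSrc a b d') t ∈ walkBoundaries a b := by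
  classical
  refine mem_image.2 ⟨((d, decide (s = 1)), (d', decide (t = 1))), mem_univ _, ?_⟩
  rcases hs with rfl | rfl <;> rcases ht with rfl | rfl <;> simp

theorem card_walkBoundaries_le (a b : E → V) :
    #(walkBoundaries a b) ≤ 16 * Fintype.card E ^ 2 := by
  classical
  refine card_image_le.trans ?_
  simp only [card_univ, Fintype.card_prod, Fintype.card_bool]
  nlinarith

variable [DecidableEq E]

/-- A signed single edge. -/
def IsUnitEdge (z : E → ℤ) : Prop := ∃ e : E, ∃ s : ℤ, (s = 1 ∨ s = -1) ∧ z = Pi.single e s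

/-- The signed edge vectors in `ℤ ^ E`. -/
def unitEdges (E : Type*) [Fintype E] [DecidableEq E] : Finset (E → ℤ) :=
  univ.image fun p : E × Bool => Pi.single p.1 (if p.2 then 1 else -1)

theorem IsUnitEdge.mem_unitEdges {z : E → ℤ} (h : IsUnitEdge z) : z ∈ unitEdges E := by
  obtain ⟨e, s, rfl | rfl, rfl⟩ := h
  · exact mem_image.2 ⟨(e, true), mem_univ _, by simp⟩
  · exact mem_image.2 ⟨(e, false), mem_univ _, by simp⟩

theorem IsUnitEdge.sum_abs {z : E → ℤ} (h : IsUnitEdge z) : ∑ e, |z e| = 1 := by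
  obtain ⟨e, s, hs, rfl⟩ := h
  rw [sum_eq_single e]
  · rcases hs with rfl | rfl <;> simp
  · intro f _ hf
    simp [hf]
  · simp

theorem card_unitEdges_le : #(unitEdges E) ≤ 2 * Fintype.card E := by
  refine card_image_le.trans ?_
  simp only [card_univ, Fintype.card_prod, Fintype.card_bool]
  omega

/-- A vector in the kernel of the boundary that is less than twice as long as a shortest one is
traversed by a closed alternating walk. -/
theorem exists_alternating_walk (a b : E → V) {S : Set E} {r : ℤ}
    (hr : ∀ v : E → ℤ, (∀ e ∉ S, v e = 0) → boundary a b v = 0 → v ≠ 0 → r ≤ ∑ e, |v e|)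
    {v : E → ℤ} (hvS : ∀ e ∉ S, v e = 0) (hv : boundary a b v = 0) (hv0 : v ≠ 0)
    (hvr : ∑ e, |v e| < 2 * r) {l : ℕ} (hl : ∑ e, |v e| = l) :
    ∃ x : ℕ → E → ℤ, x 0 = 0 ∧ x l = v ∧ (∀ n ≤ l, ∀ e ∉ S, x n e = 0) ∧
      (∀ n < l, IsUnitEdge (x (n + 1) - x n)) ∧
      ∃ d₀ : E × Bool, ∀ n ≤ l, ∃ d : E × Bool, boundary a b (x n) =
        Pi.single (dartSrc a b d₀) 1 - Pi.single (dartSrc a b d) ((-1) ^ n) := by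
  obtain ⟨d₀, hd₀⟩ : ∃ d₀ : E × Bool, 0 < v d₀.1 := by
    obtain ⟨e, he⟩ := Function.ne_iff.1 hv0
    rcases lt_or_gt_of_ne he with h | h
    · obtain ⟨d, -, hd⟩ := exists_dart_neg a b (x := -v) (by rw [boundary_neg, hv, neg_zero])
        (e, true) (by simpa using h)
      exact ⟨d, by simpa using hd⟩
    · exact ⟨(e, true), h⟩
  -- Invariant of a greedy walk: `x` is a part of `v` with no cancellation between `x` and `v - x`,
  -- it has length `n`, and its boundary sits at the start and the current end.
  let P : ℕ → (E → ℤ) → Prop := fun n x =>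
    (∀ e, |x e| + |v e - x e| = |v e|) ∧ ∑ e, |x e| = n ∧
      ∃ d : E × Bool, boundary a b x =
        Pi.single (dartSrc a b d₀) 1 - Pi.single (dartSrc a b d) ((-1) ^ n)
  have hP0 : P 0 0 := by
    refine ⟨by simp, by simp, d₀, ?_⟩
    rw [boundary_zero, pow_zero, sub_self]
  have hstep : ∀ n < l, ∀ x, P n x → ∃ x', P (n + 1) x' ∧ IsUnitEdge (x' - x) := by
    rintro n hn x ⟨hconf, hnorm, d, hd⟩
    obtain ⟨s, hs⟩ : ∃ s : ℤ, s = (-1) ^ n := ⟨_, rfl⟩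
    have hs1 : s = 1 ∨ s = -1 := by rw [hs]; exact neg_one_pow_eq_or ℤ n
    have hss : s * s = 1 := by rcases hs1 with rfl | rfl <;> rfl
    rw [← hs] at hd
    obtain ⟨d', hd', hpos⟩ : ∃ d' : E × Bool, dartSrc a b d' = dartSrc a b d ∧
        0 < s * (v d'.1 - x d'.1) := by
      by_cases hclosed : boundary a b x = 0
      · have hsd : dartSrc a b d = dartSrc a b d₀ ∧ s = 1 := by
          have h1 := congr_fun (hd.symm.trans hclosed) (dartSrc a b d₀)
          rw [Pi.sub_apply, Pi.single_eq_same, Pi.single_apply] at h1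
          split_ifs at h1 with h2
          · refine ⟨h2.symm, ?_⟩
            have h3 : (1 : ℤ) - s = 0 := h1
            omega
          · simp at h1
        rcases Nat.eq_zero_or_pos n with rfl | hn0
        · have hx0 : x = 0 := by
            ext e
            have := (sum_eq_zero_iff_of_nonneg fun e _ => abs_nonneg (x e)).1
              (by simpa using hnorm) e (mem_univ _)
            simpa using this
          exact ⟨d₀, hsd.1.symm, by simpa [hx0, hsd.2] using hd₀⟩
        -- If the walk closes early, `v` splits without cancellation into two nonzero kernel
        -- vectors. Each has length at least `r`, contradicting that `v` is shorter than `2 * r`.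
        · exfalso
          have hxS : ∀ e ∉ S, x e = 0 := by
            intro e he
            have := hconf e
            rw [hvS e he] at this
            have h1 := abs_nonneg (x e)
            have h2 := abs_nonneg (0 - x e)
            rw [abs_zero] at this
            exact abs_eq_zero.1 (by omega)
          have h1 : r ≤ ∑ e, |x e| := by
            refine hr x hxS hclosed ?_
            rintro rfl
            simp at hnorm
            omega
          have h2 : ∑ e, |x e| + ∑ e, |v e - x e| = ∑ e, |v e| := by
            rw [← sum_add_distrib]
            exact sum_congr rfl fun e _ => hconf e
          have h3 : r ≤ ∑ e, |(v - x) e| := by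
            refine hr (v - x) (fun e he => by simp [hvS e he, hxS e he])
              (by rw [boundary_sub, hv, hclosed, sub_zero]) ?_
            intro h0
            have : ∑ e, |v e - x e| = 0 := sum_eq_zero fun e _ => by
              have := congr_fun h0 e
              simp only [Pi.sub_apply, Pi.zero_apply] at this
              rw [this, abs_zero]
            rw [this, hnorm, hl] at h2
            omega
          simp only [Pi.sub_apply] at h3
          omega
      -- If the walk is still open, the rest `v - x` has boundary of sign `s` at the current end, so
      -- an edge with that sign is left there.
      · have hb : boundary a b (s • (v - x)) =
            Pi.single (dartSrc a b d) 1 - Pi.single (dartSrc a b d₀) s := by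
          have : s • (v - x) = fun e => s * (v - x) e := rfl
          have h2 : boundary a b (s • (v - x)) = s • boundary a b (v - x) := by
            ext u
            simp [boundary, mul_sum, mul_assoc]
          rw [h2, boundary_sub, hv, hd, zero_sub, neg_sub, smul_sub, ← Pi.single_smul,
            ← Pi.single_smul, smul_eq_mul, smul_eq_mul, hss, mul_one]
        obtain ⟨d', h1, h2⟩ := exists_dart_pos a b (x := s • (v - x)) (u := dartSrc a b d) (by
          rw [hb, Pi.sub_apply, Pi.single_eq_same, Pi.single_apply]
          split_ifs with h
          · rcases hs1 with rfl | rfl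
            · rw [h, sub_self] at hd
              exact absurd hd hclosed
            · norm_num
          · norm_num)
        exact ⟨d', h1, by simpa using h2⟩
    refine ⟨x + Pi.single d'.1 s, ⟨?_, ?_, ?_⟩, d'.1, s, hs1, by simp⟩
    · intro e
      by_cases he : e = d'.1
      · subst he
        have := hconf d'.1
        simp only [Pi.add_apply, Pi.single_eq_same]
        rcases hs1 with rfl | rfl
        · grind
        · grind
      · simpa [he] using hconf e
    · rw [Nat.cast_add, Nat.cast_one, ← hnorm, ← sub_eq_iff_eq_add', ← sum_sub_distrib,
        sum_eq_single d'.1]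
      · have := hconf d'.1
        simp only [Pi.add_apply, Pi.single_eq_same]
        rcases hs1 with rfl | rfl
        · grind
        · grind
      · intro e _ he
        simp [he]
      · simp
    · obtain ⟨d'', hd''⟩ := exists_dart_tgt a b d'
      refine ⟨d'', ?_⟩
      rw [boundary_add, hd, boundary_single_dart, hd', hd'', pow_succ, ← hs, mul_neg_one,
        Pi.single_neg]
      abel
  obtain ⟨x, hx0, hxP, hxstep⟩ := exists_chain_of_step hP0 hstep
  refine ⟨x, hx0, ?_, ?_, hxstep, d₀, fun n hn => (hxP n hn).2.2⟩
  · obtain ⟨hconf, hnorm, -⟩ := hxP l le_rfl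
    ext e
    have h2 : ∑ e, |x l e| + ∑ e, |v e - x l e| = ∑ e, |v e| := by
      rw [← sum_add_distrib]
      exact sum_congr rfl fun e _ => hconf e
    have h3 : ∑ e, |v e - x l e| = 0 := by omega
    have := (sum_eq_zero_iff_of_nonneg fun e _ => abs_nonneg (v e - x l e)).1 h3 e (mem_univ _)
    exact (sub_eq_zero.1 (abs_eq_zero.1 this)).symm
  · intro n hn e he
    have := (hxP n hn).1 e
    rw [hvS e he, abs_zero] at this
    have h1 := abs_nonneg (x n e)
    have h2 := abs_nonneg (0 - x n e)
    exact abs_eq_zero.1 (by omega)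

/-- The decomposition of a near-shortest vector into four pieces with few possible boundaries, each
of at most a quarter of its length, and at most three single edges. -/
theorem exists_four_pieces (a b : E → V) {S : Set E} {r : ℤ}
    (hr : ∀ v : E → ℤ, (∀ e ∉ S, v e = 0) → boundary a b v = 0 → v ≠ 0 → r ≤ ∑ e, |v e|)
    {v : E → ℤ} (hvS : ∀ e ∉ S, v e = 0) (hv : boundary a b v = 0) (hv0 : v ≠ 0)
    (hvr : ∑ e, |v e| < 2 * r) :
    ∃ (p : Fin 4 → E → ℤ) (u : Fin 3 → E → ℤ), v = ∑ i, p i + ∑ i, u i ∧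
      (∀ i, boundary a b (p i) ∈ walkBoundaries a b) ∧ (∀ i, ∀ e ∉ S, p i e = 0) ∧
      (∀ i, 4 * ∑ e, |p i e| ≤ ∑ e, |v e|) ∧ ∀ i, u i ∈ insert 0 (unitEdges E) := by
  obtain ⟨l, hl⟩ : ∃ l : ℕ, ∑ e, |v e| = l :=
    ⟨_, (Int.toNat_of_nonneg (sum_nonneg fun e _ => abs_nonneg (v e))).symm⟩
  obtain ⟨x, hx0, hxl, hxS, hxstep, d₀, hxb⟩ :=
    exists_alternating_walk a b hr hvS hv hv0 hvr hl
  have hnorm : ∀ n k, n + k ≤ l → ∑ e, |(x (n + k) - x n) e| ≤ k := by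
    intro n k
    induction k with
    | zero => simp
    | succ k ih =>
      intro hk
      have h1 := (hxstep (n + k) (by omega)).sum_abs
      calc ∑ e, |(x (n + (k + 1)) - x n) e|
          ≤ ∑ e, (|(x (n + k) - x n) e| + |(x (n + k + 1) - x (n + k)) e|) := by
            refine sum_le_sum fun e _ => ?_
            have : (x (n + (k + 1)) - x n) e =
                (x (n + k) - x n) e + (x (n + k + 1) - x (n + k)) e := by
              simp only [Pi.sub_apply, ← add_assoc]
              ring
            rw [this]
            exact abs_add_le _ _
        _ ≤ k + 1 := by rw [sum_add_distrib, h1]; exact add_le_add (ih (by omega)) le_rfl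
        _ = _ := by push_cast; rfl
  have hsign : ∀ n : ℕ, ((-1 : ℤ) ^ n = 1 ∨ (-1 : ℤ) ^ n = -1) := fun n => neg_one_pow_eq_or ℤ n
  have hbd : ∀ n k, n + k ≤ l → boundary a b (x (n + k) - x n) ∈ walkBoundaries a b := by
    intro n k hk
    obtain ⟨d, hd⟩ := hxb n (by omega)
    obtain ⟨d', hd'⟩ := hxb (n + k) hk
    rw [boundary_sub, hd, hd', sub_sub_sub_cancel_left, sub_eq_add_neg, ← Pi.single_neg]
    refine mem_walkBoundaries a b (hsign n) ?_ d d'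
    rcases hsign (n + k) with h | h <;> simp [h]
  -- The pieces are four consecutive stretches of `q` steps; the at most three steps that remain are
  -- the single edges. The minimum in `t` turns missing ones into zero.
  set q := l / 4 with hq
  let t : ℕ → ℕ := fun i => min (4 * q + i) l
  refine ⟨fun i => x (i * q + q) - x (i * q), fun i => x (t (i + 1)) - x (t i), ?_, ?_, ?_, ?_, ?_⟩
  · rw [Fin.sum_univ_four, Fin.sum_univ_three]
    have e1 : t 3 = l := by simp only [t]; omega
    have e0 : t 0 = 4 * q := by simp only [t]; omega
    have : v = x (t 3) := by rw [e1, hxl]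
    rw [this]
    simp only [Fin.isValue, Fin.coe_ofNat_eq_mod, Nat.reduceMod,
      Nat.reduceAdd]
    rw [show 0 * q + q = 1 * q by ring,
      show 1 * q + q = 2 * q by ring, show 2 * q + q = 3 * q by ring,
      show 3 * q + q = 4 * q by ring, zero_mul, hx0, e0]
    abel
  · intro i
    exact hbd _ _ (by fin_cases i <;> simp <;> omega)
  · intro i e he
    have h : (i : ℕ) * q + q ≤ l := by fin_cases i <;> simp <;> omega
    change x (i * q + q) e - x (i * q) e = 0
    rw [hxS _ h e he, hxS _ (by omega) e he, sub_zero]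
  · intro i
    have h : (i : ℕ) * q + q ≤ l := by fin_cases i <;> simp <;> omega
    have := hnorm _ _ h
    rw [hl]
    change 4 * ∑ e, |(x (i * q + q) - x (i * q)) e| ≤ _
    omega
  · intro i
    by_cases h : 4 * q + i < l
    · have h1 : t (i + 1) = 4 * q + i + 1 := by simp only [t]; omega
      have h2 : t i = 4 * q + i := by simp only [t]; omega
      simp only [h1, h2]
      exact mem_insert_of_mem (hxstep _ h).mem_unitEdges
    · have h1 : t (i + 1) = l := by simp only [t]; omega
      have h2 : t i = l := by simp only [t]; omega
      simp only [h1, h2, sub_self]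
      exact mem_insert_self _ _

/-- There are few near-shortest vectors in the integral kernel of the boundary. -/
theorem exists_card_near_shortest_le (a b : E → V) {S : Set E} {r : ℤ}
    (hr : ∀ v : E → ℤ, (∀ e ∉ S, v e = 0) → boundary a b v = 0 → v ≠ 0 → r ≤ ∑ e, |v e|) :
    ∃ T : Finset (E → ℤ), #T ≤ (16 * Fintype.card E ^ 2) ^ 4 * (2 * Fintype.card E + 1) ^ 3 ∧
      ∀ v, v ∈ T ↔ (∀ e ∉ S, v e = 0) ∧ boundary a b v = 0 ∧ v ≠ 0 ∧ ∑ e, |v e| < 2 * r := by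
  let X : Set (E → ℤ) :=
    {v | (∀ e ∉ S, v e = 0) ∧ boundary a b v = 0 ∧ v ≠ 0 ∧ ∑ e, |v e| < 2 * r}
  have hp : ∀ v : E → ℤ, ∃ (p : Fin 4 → E → ℤ) (u : Fin 3 → E → ℤ), v ∈ X →
      v = ∑ i, p i + ∑ i, u i ∧
      (∀ i, boundary a b (p i) ∈ walkBoundaries a b) ∧ (∀ i, ∀ e ∉ S, p i e = 0) ∧
      (∀ i, 4 * ∑ e, |p i e| ≤ ∑ e, |v e|) ∧ ∀ i, u i ∈ insert 0 (unitEdges E) := by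
    intro v
    by_cases h : v ∈ X
    · obtain ⟨p, u, h'⟩ := exists_four_pieces a b hr h.1 h.2.1 h.2.2.1 h.2.2.2
      exact ⟨p, u, fun _ => h'⟩
    · exact ⟨0, 0, fun h' => absurd h' h⟩
  choose p u hpu using hp
  let C : Finset ((Fin 4 → V → ℤ) × (Fin 3 → E → ℤ)) :=
    Fintype.piFinset (fun _ => walkBoundaries a b) ×ˢ
      Fintype.piFinset (fun _ => insert 0 (unitEdges E))
  let f : (E → ℤ) → (Fin 4 → V → ℤ) × (Fin 3 → E → ℤ) := fun v =>
    (fun i => boundary a b (p v i), u v)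
  have hmaps : Set.MapsTo f X C := by
    intro v hv
    obtain ⟨-, h1, -, -, h2⟩ := hpu v hv
    simp only [C, f, coe_product, Set.mem_prod, mem_coe, Fintype.mem_piFinset]
    exact ⟨h1, h2⟩
  -- Two pieces with the same boundary differ by a kernel vector of length at most a quarter of the
  -- sum of the two lengths, hence less than `r`. So they are equal, and the boundaries together
  -- with the single edges determine `v`.
  have hinj : Set.InjOn f X := by
    intro v hv v' hv' hff
    obtain ⟨h1, -, h2, h3, -⟩ := hpu v hv
    obtain ⟨h1', -, h2', h3', -⟩ := hpu v' hv'
    have hu : u v = u v' := congr_arg Prod.snd hff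
    have hpp : p v = p v' := by
      funext i
      have hb : boundary a b (p v i) = boundary a b (p v' i) :=
        congr_fun (congr_arg Prod.fst hff) i
      by_contra hne
      have h4 := hr (p v i - p v' i) (fun e he => by simp [h2 i e he, h2' i e he])
        (by rw [boundary_sub, hb, sub_self]) (sub_ne_zero.2 hne)
      have h5 : ∑ e, |(p v i - p v' i) e| ≤ ∑ e, |p v i e| + ∑ e, |p v' i e| := by
        rw [← sum_add_distrib]
        exact sum_le_sum fun e _ => abs_sub _ _
      have h6 := h3 i
      have h7 := h3' i
      have h8 := hv.2.2.2
      have h9 := hv'.2.2.2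
      omega
    rw [h1, h1', hu, hpp]
  have hfin : X.Finite := Set.Finite.of_injOn hmaps hinj C.finite_toSet
  refine ⟨hfin.toFinset, ?_, fun v => hfin.mem_toFinset⟩
  have h1 : #hfin.toFinset ≤ #C := card_le_card_of_injOn f
    (fun v hv => hmaps (hfin.mem_toFinset.1 hv)) (fun v hv v' hv' h =>
      hinj (hfin.mem_toFinset.1 hv) (hfin.mem_toFinset.1 hv') h)
  refine h1.trans ?_
  simp only [C, card_product, Fintype.card_piFinset_const]
  refine Nat.mul_le_mul (Nat.pow_le_pow_left (card_walkBoundaries_le a b) 4)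
    (Nat.pow_le_pow_left ((card_insert_le _ _).trans ?_) 3)
  exact Nat.add_le_add_right card_unitEdges_le 1

end NearShortest
-- The matroid matching polytope: uncrossing and the multigraph of a maximal tight chain.
section Valuation

open Module

variable {K : Type*} [Field K] {n m : ℕ}

/-- The dimension of the intersection of a subspace with the `i`-th line. -/
noncomputable def meetRank (l : Fin m → Submodule K (Fin n → K)) (U : Submodule K (Fin n → K))
    (i : Fin m) : ℕ := finrank K ↥(U ⊓ l i)

variable {l : Fin m → Submodule K (Fin n → K)}

theorem meetRank_mono {U W : Submodule K (Fin n → K)} (h : U ≤ W) (i : Fin m) :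
    meetRank l U i ≤ meetRank l W i :=
  Submodule.finrank_mono (inf_le_inf_right _ h)

theorem meetRank_bot (i : Fin m) : meetRank l ⊥ i = 0 := by
  rw [meetRank, bot_inf_eq, finrank_bot]

theorem meetRank_le_two (hl : ∀ i, finrank K (l i) = 2) (U : Submodule K (Fin n → K)) (i : Fin m) :
    meetRank l U i ≤ 2 :=
  (Submodule.finrank_mono inf_le_right).trans (hl i).le

/-- The dimension formula for `U ⊓ l i` and `W ⊓ l i`, whose sum lies in `(U ⊔ W) ⊓ l i` but may be
smaller. -/
theorem meetRank_add_le (U W : Submodule K (Fin n → K)) (i : Fin m) :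
    meetRank l U i + meetRank l W i ≤ meetRank l (U ⊔ W) i + meetRank l (U ⊓ W) i := by
  have h := Submodule.finrank_sup_add_finrank_inf_eq (U ⊓ l i) (W ⊓ l i)
  have h1 : (U ⊓ l i) ⊓ (W ⊓ l i) = (U ⊓ W) ⊓ l i := by
    rw [inf_inf_inf_comm, inf_idem]
  have h2 : (U ⊓ l i) ⊔ (W ⊓ l i) ≤ (U ⊔ W) ⊓ l i :=
    sup_le (inf_le_inf_right _ le_sup_left) (inf_le_inf_right _ le_sup_right)
  rw [h1] at h
  unfold meetRank
  have h3 := Submodule.finrank_mono h2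
  omega

/-- The system of inequalities that defines the fractional matroid matching polytope. -/
noncomputable def matchingConstraints (l : Fin m → Submodule K (Fin n → K)) :
    Set ((Fin m → ℝ) × ℝ) :=
  Set.range (fun i => (-Pi.single i 1, 0)) ∪
    Set.range fun U : Submodule K (Fin n → K) => (fun i => (meetRank l U i : ℝ), (finrank K U : ℝ))

/-- Over an infinite field there can be infinitely many subspaces, but an inequality depends only on
dimensions, which are bounded by `2` and `n`. -/
theorem finite_matchingConstraints (hl : ∀ i, finrank K (l i) = 2) :
    (matchingConstraints l).Finite := by
  refine (Set.finite_range _).union ?_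
  let g : ((Fin m → ℕ) × ℕ) → (Fin m → ℝ) × ℝ := fun p => (fun i => (p.1 i : ℝ), (p.2 : ℝ))
  refine (((Set.finite_Icc (0 : Fin m → ℕ) fun _ => 2).prod (Set.finite_Iic n)).image g).subset ?_
  rintro _ ⟨U, rfl⟩
  refine ⟨(meetRank l U, finrank K U), ⟨⟨fun _ => Nat.zero_le _,
    fun i => meetRank_le_two hl U i⟩, ?_⟩, rfl⟩
  simpa using Submodule.finrank_le U

theorem polyhedron_matchingConstraints :
    polyhedron (matchingConstraints l) = fractionalMatroidMatchingPolytope l := by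
  ext y
  simp only [polyhedron, matchingConstraints, fractionalMatroidMatchingPolytope, Set.mem_ofPred_eq,
    Set.mem_union, Set.mem_range, or_imp, forall_and, forall_exists_index,
    forall_apply_eq_imp_iff]
  refine and_congr (forall_congr' fun i => ?_) (forall_congr' fun U => ?_)
  · rw [neg_dotProduct, single_one_dotProduct, neg_nonpos]
  · simp only [dotProduct, meetRank, mul_comm]

/-- The inequality for the subspace `l i` itself already contains the term `2 * y i ≤ 2`. -/
theorem le_one_of_mem_matchingPolytope (hl : ∀ i, finrank K (l i) = 2) {y : Fin m → ℝ}
    (hy : y ∈ fractionalMatroidMatchingPolytope l) (i : Fin m) : y i ≤ 1 := by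
  have h := hy.2 (l i)
  rw [hl i] at h
  have h1 : y i * (finrank K ↥(l i ⊓ l i) : ℝ) ≤ ∑ j, y j * (finrank K ↥(l i ⊓ l j) : ℝ) :=
    Finset.single_le_sum (f := fun j => y j * (finrank K ↥(l i ⊓ l j) : ℝ))
      (fun j _ => mul_nonneg (hy.1 j) (Nat.cast_nonneg _)) (Finset.mem_univ i)
  rw [inf_idem, hl i] at h1
  push_cast at h h1
  linarith

theorem isCompact_matchingPolytope (hl : ∀ i, finrank K (l i) = 2) :
    IsCompact (fractionalMatroidMatchingPolytope l) := by
  refine (isCompact_Icc (a := (0 : Fin m → ℝ)) (b := 1)).of_isClosed_subset ?_ ?_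
  · rw [← polyhedron_matchingConstraints]
    exact isClosed_polyhedron _
  · exact fun y hy => ⟨hy.1, le_one_of_mem_matchingPolytope hl hy⟩

theorem matchingPolytope_nonempty : (fractionalMatroidMatchingPolytope l).Nonempty :=
  ⟨0, fun _ => le_rfl, fun U => by simp⟩

/-- The rank inequality of `U` is tight at `y`. -/
def IsTight (l : Fin m → Submodule K (Fin n → K)) (y : Fin m → ℝ) (U : Submodule K (Fin n → K)) :
    Prop := ∑ i, y i * meetRank l U i = finrank K U

theorem isFlatDirection_iff {y x : Fin m → ℝ} :
    IsFlatDirection (matchingConstraints l) y x ↔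
      (∀ i, y i = 0 → x i = 0) ∧ ∀ U, IsTight l y U → ∑ i, x i * meetRank l U i = 0 := by
  simp only [IsFlatDirection, matchingConstraints, Set.mem_union, Set.mem_range, or_imp,
    forall_and, forall_exists_index, forall_apply_eq_imp_iff]
  refine and_congr (forall_congr' fun i => ?_) (forall_congr' fun U => ?_)
  · rw [neg_dotProduct, neg_dotProduct, single_one_dotProduct, single_one_dotProduct, neg_eq_zero,
      neg_eq_zero]
  · simp only [dotProduct, IsTight, mul_comm]

theorem isTight_bot (y : Fin m → ℝ) : IsTight l y ⊥ := by
  simp [IsTight, meetRank_bot]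

/-- Tight subspaces are closed under sums and intersections, and the dimension of the intersection
with a line in the support is modular on them. -/
theorem IsTight.uncross {y : Fin m → ℝ} (hy : y ∈ fractionalMatroidMatchingPolytope l)
    {U W : Submodule K (Fin n → K)} (hU : IsTight l y U) (hW : IsTight l y W) :
    IsTight l y (U ⊔ W) ∧ IsTight l y (U ⊓ W) ∧ ∀ i, y i ≠ 0 →
      meetRank l U i + meetRank l W i = meetRank l (U ⊔ W) i + meetRank l (U ⊓ W) i := by
  have hdim : (finrank K ↥(U ⊔ W) : ℝ) + finrank K ↥(U ⊓ W) = finrank K U + finrank K W := by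
    exact_mod_cast Submodule.finrank_sup_add_finrank_inf_eq U W
  have h1 : ∑ i, y i * (meetRank l (U ⊔ W) i : ℝ) ≤ finrank K ↥(U ⊔ W) := hy.2 (U ⊔ W)
  have h2 : ∑ i, y i * (meetRank l (U ⊓ W) i : ℝ) ≤ finrank K ↥(U ⊓ W) := hy.2 (U ⊓ W)
  unfold IsTight at *
  -- The slack of supermodularity, weighted by `y`. Its terms are nonnegative, and the inequalities
  -- for sum and intersection bound the total by zero, so every term vanishes.
  let s : Fin m → ℝ := fun i => y i * (((meetRank l (U ⊔ W) i : ℝ) + meetRank l (U ⊓ W) i) -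
    (meetRank l U i + meetRank l W i))
  have hs0 : ∀ i, 0 ≤ s i := by
    intro i
    refine mul_nonneg (hy.1 i) (sub_nonneg.2 ?_)
    exact_mod_cast meetRank_add_le U W i
  have hs : ∑ i, s i = (∑ i, y i * (meetRank l (U ⊔ W) i : ℝ) +
      ∑ i, y i * (meetRank l (U ⊓ W) i : ℝ)) -
      (∑ i, y i * (meetRank l U i : ℝ) + ∑ i, y i * (meetRank l W i : ℝ)) := by
    simp only [s, ← Finset.sum_add_distrib, ← Finset.sum_sub_distrib]
    exact Finset.sum_congr rfl fun i _ => by ring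
  have hs1 : 0 ≤ ∑ i, s i := Finset.sum_nonneg fun i _ => hs0 i
  have hs2 : ∑ i, s i = 0 := by linarith
  refine ⟨by linarith, by linarith, fun i hi => ?_⟩
  have h3 := (Finset.sum_eq_zero_iff_of_nonneg fun i _ => hs0 i).1 hs2 i (Finset.mem_univ i)
  have h4 := (mul_eq_zero.1 h3).resolve_left hi
  have h5 : (meetRank l U i : ℝ) + meetRank l W i =
      meetRank l (U ⊔ W) i + meetRank l (U ⊓ W) i := by linarith
  exact_mod_cast h5

/-- A maximal chain in a family of subspaces that is closed under sums. -/
theorem exists_maximal_chain {T : Set (Submodule K (Fin n → K))} (hbot : ⊥ ∈ T)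
    (hsup : ∀ U ∈ T, ∀ W ∈ T, U ⊔ W ∈ T) :
    ∃ c : ℕ → Submodule K (Fin n → K), c 0 = ⊥ ∧ Monotone c ∧ (∀ j, c j ∈ T) ∧
      (∀ j, ∀ W ∈ T, c j ≤ W → W ≤ c (j + 1) → W = c j ∨ W = c (j + 1)) ∧
      (∀ j, ∀ W ∈ T, n ≤ j → W ≤ c j) := by
  -- The successor of `U` is a minimal member of `T` properly above it, or `U` itself if there is
  -- none.
  have hnext : ∀ U, ∃ U', U ≤ U' ∧ (U ∈ T → U' ∈ T) ∧
      (∀ W ∈ T, U ≤ W → W ≤ U' → W = U ∨ W = U') ∧ ((∃ W ∈ T, U < W) → U < U') := by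
    intro U
    by_cases h : ∃ W ∈ T, U < W
    · obtain ⟨W₀, hW₀, hU⟩ := h
      obtain ⟨U', ⟨hT, hlt⟩, hmin⟩ := WellFounded.has_min
        (wellFounded_lt (α := Submodule K (Fin n → K))) {W | W ∈ T ∧ U < W} ⟨W₀, hW₀, hU⟩
      refine ⟨U', hlt.le, fun _ => hT, fun W hW h1 h2 => ?_, fun _ => hlt⟩
      rcases h1.eq_or_lt with rfl | h1
      · exact Or.inl rfl
      · exact Or.inr (h2.eq_or_lt.resolve_right (hmin W ⟨hW, h1⟩))
    · exact ⟨U, le_rfl, id, fun W _ h1 h2 => Or.inl (le_antisymm h2 h1), fun h' => absurd h' h⟩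
  choose g hg1 hg2 hg3 hg4 using hnext
  let c : ℕ → Submodule K (Fin n → K) := fun j => g^[j] ⊥
  have hc : ∀ j, c (j + 1) = g (c j) := fun j => Function.iterate_succ_apply' _ _ _
  have hcT : ∀ j, c j ∈ T := by
    intro j
    induction j with
    | zero => exact hbot
    | succ j ih => rw [hc]; exact hg2 _ ih
  -- As long as the chain has not reached the top of `T`, every step raises the dimension, so it is
  -- at the top after `n` steps.
  have hrank : ∀ j, (∃ W ∈ T, ¬ W ≤ c j) → j ≤ finrank K (c j) := by
    intro j
    induction j with
    | zero => exact fun _ => Nat.zero_le _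
    | succ j ih =>
      rintro ⟨W, hW, hWc⟩
      have hlt : c j < c (j + 1) := by
        rw [hc]
        refine hg4 _ ⟨c j ⊔ W, hsup _ (hcT j) _ hW, left_lt_sup.2 fun h => hWc ?_⟩
        rw [hc]
        exact h.trans (hg1 _)
      have h1 := ih ⟨W, hW, fun h => hWc (h.trans hlt.le)⟩
      have h2 := Submodule.finrank_lt_finrank_of_lt hlt
      omega
  refine ⟨c, rfl, monotone_nat_of_le_succ fun j => hc j ▸ hg1 _, hcT, fun j W hW => ?_,
    fun j W hW hj => ?_⟩
  · rw [hc]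
    exact hg3 _ W hW
  · by_contra h
    have h1 := hrank j ⟨W, hW, h⟩
    have h2 : finrank K (c j) < n := by
      have h3 : c j < ⊤ := lt_top_iff_ne_top.2 fun h' => h (h' ▸ le_top)
      simpa using Submodule.finrank_lt h3.ne
    omega

/-- The threshold `t` is crossed exactly at the infimum. If it is never reached, the infimum of the
empty set is `0`, which is not of the form `j + 1`, so it contributes no step. -/
theorem threshold_succ {g : ℕ → ℕ} (hg : Monotone g) (t j : ℕ) :
    (if t ≤ g (j + 1) then 1 else 0) =
      (if t ≤ g j then 1 else 0) + if sInf {k | t ≤ g k} = j + 1 then 1 else 0 := by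
  by_cases h : t ≤ g j
  · have h1 : t ≤ g (j + 1) := h.trans (hg j.le_succ)
    have h2 : sInf {k | t ≤ g k} ≠ j + 1 := fun h' => by
      have : sInf {k | t ≤ g k} ≤ j := Nat.sInf_le h
      omega
    rw [if_pos h1, if_pos h, if_neg h2]
  · by_cases h1 : t ≤ g (j + 1)
    · have h2 : sInf {k | t ≤ g k} = j + 1 := by
        refine le_antisymm (Nat.sInf_le h1) (Nat.succ_le_of_lt (lt_of_not_ge fun h' => h ?_))
        exact le_trans (Nat.sInf_mem (s := {k | t ≤ g k}) ⟨_, h1⟩) (hg h')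
      rw [if_pos h1, if_neg h, if_pos h2]
    · have h2 : sInf {k | t ≤ g k} ≠ j + 1 := by
        intro h'
        have hne : {k | t ≤ g k}.Nonempty := by
          by_contra hne
          rw [Set.not_nonempty_iff_eq_empty.1 hne, Nat.sInf_empty] at h'
          omega
        have := Nat.sInf_mem hne
        rw [h'] at this
        exact h1 this
      rw [if_neg h1, if_neg h, if_neg h2]

/-- A monotone sequence from `0` to at most `2` is a sum of two steps. -/
theorem two_steps_succ {g : ℕ → ℕ} (hg : Monotone g) (h2 : ∀ j, g j ≤ 2) (j : ℕ) :
    g (j + 1) = g j + ((if sInf {k | 1 ≤ g k} = j + 1 then 1 else 0) +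
      if sInf {k | 2 ≤ g k} = j + 1 then 1 else 0) := by
  have key : ∀ k, g k = (if 1 ≤ g k then 1 else 0) + if 2 ≤ g k then 1 else 0 := by
    intro k
    have := h2 k
    split_ifs <;> omega
  have h3 := threshold_succ hg 1 j
  have h4 := threshold_succ hg 2 j
  have h5 := key j
  have h6 := key (j + 1)
  omega

/-- The extension of a vector by an additional entry that makes the sum zero. -/
def extendZeroSum {R : Type*} [Ring R] (x : Fin m → R) : Option (Fin m) → R
  | none => -∑ i, x i
  | some i => x i

/-- Handshake identity. It makes the equation at vertex `0` redundant for vectors with sum zero and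
forces sum zero on kernel vectors. -/
theorem sum_boundary {E R : Type*} [Fintype E] [CommRing R] (a b : E → ℕ) {N : ℕ}
    (ha : ∀ e, a e ≤ N) (hb : ∀ e, b e ≤ N) (x : E → R) :
    ∑ u ∈ Finset.range (N + 1), boundary a b x u = 2 * ∑ e, x e := by
  simp only [boundary]
  rw [Finset.sum_comm, Finset.mul_sum]
  refine Finset.sum_congr rfl fun e _ => ?_
  have h1 : a e ∈ Finset.range (N + 1) := Finset.mem_range.2 (Nat.lt_succ_of_le (ha e))
  have h2 : b e ∈ Finset.range (N + 1) := Finset.mem_range.2 (Nat.lt_succ_of_le (hb e))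
  simp only [Pi.single_apply, mul_add, Finset.sum_add_distrib, mul_ite, mul_one, mul_zero,
    Finset.sum_ite_eq', h1, h2, if_true]
  ring

theorem sum_extendZeroSum {R : Type*} [CommRing R] (x : Fin m → R) :
    ∑ e, extendZeroSum x e = 0 := by
  rw [Fintype.sum_option]
  simp [extendZeroSum]

theorem boundary_eq_zero_iff_of_sum_eq_zero {E R : Type*} [Fintype E] [CommRing R] (a b : E → ℕ)
    {N : ℕ} (ha : ∀ e, a e ≤ N) (hb : ∀ e, b e ≤ N) {x : E → R} (hx : ∑ e, x e = 0) :
    boundary a b x 0 = -∑ u ∈ Finset.range N, boundary a b x (u + 1) := by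
  have h := sum_boundary a b ha hb x
  rw [hx, mul_zero, Finset.sum_range_succ'] at h
  linear_combination h

/-- The flat directions at a point of the fractional matroid matching polytope are the kernel of
the boundary of a multigraph, whose edges are the lines and one additional loop. -/
theorem exists_multigraph (hl : ∀ i, finrank K (l i) = 2) {y : Fin m → ℝ}
    (hy : y ∈ fractionalMatroidMatchingPolytope l) :
    ∃ a b : Option (Fin m) → ℕ,
      (∀ x : Fin m → ℝ, (∀ i, y i = 0 → x i = 0) →
        (IsFlatDirection (matchingConstraints l) y x ↔ boundary a b (extendZeroSum x) = 0)) ∧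
      (∀ u, ∃ k : ℤ, boundary a b (extendZeroSum y) u = k) ∧
      ∀ x : Option (Fin m) → ℝ, boundary a b x = 0 → x = extendZeroSum fun i => x (some i) := by
  obtain ⟨c, hc0, hcmono, hcT, hcmax, hctop⟩ := exists_maximal_chain (T := {U | IsTight l y U})
    (isTight_bot y) fun U hU W hW => (IsTight.uncross hy hU hW).1
  have hstab : ∀ j, n ≤ j → c j = c n := fun j hj =>
    le_antisymm (hctop n _ (hcT j) le_rfl) (hcmono hj)
  -- An end of the edge of a line is the position in the chain where its intersection dimension
  -- reaches `t`. Vertex `0` collects thresholds that are never reached and both ends of the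
  -- additional edge.
  let st : ℕ → Option (Fin m) → ℕ := fun t e => e.elim 0 fun i => sInf {k | t ≤ meetRank l (c k) i}
  have hst : ∀ t, 1 ≤ t → ∀ e, st t e ≤ n := by
    rintro t ht (_ | i)
    · exact Nat.zero_le _
    · change sInf {k | t ≤ meetRank l (c k) i} ≤ n
      by_contra h
      push Not at h
      have hne : {k | t ≤ meetRank l (c k) i}.Nonempty := by
        by_contra hne
        rw [Set.not_nonempty_iff_eq_empty.1 hne, Nat.sInf_empty] at h
        omega
      have h1 := Nat.sInf_mem hne
      rw [Set.mem_ofPred_eq, hstab _ h.le] at h1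
      exact absurd (Nat.sInf_le (s := {k | t ≤ meetRank l (c k) i}) h1) (not_le.2 h)
  -- The boundary at vertex `j + 1` is the difference of the left sides of the constraints of two
  -- consecutive chain members.
  have hstep : ∀ (x : Fin m → ℝ) (j : ℕ), boundary (st 1) (st 2) (extendZeroSum x) (j + 1) =
      ∑ i, x i * meetRank l (c (j + 1)) i - ∑ i, x i * meetRank l (c j) i := by
    intro x j
    rw [boundary, Fintype.sum_option, ← Finset.sum_sub_distrib]
    have h0 : ∀ t, (Pi.single (st t none) (1 : ℝ) : ℕ → ℝ) (j + 1) = 0 := fun t =>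
      Pi.single_eq_of_ne (by simp [st]) _
    rw [h0, h0, add_zero, mul_zero, zero_add]
    refine Finset.sum_congr rfl fun i _ => ?_
    have h := two_steps_succ (g := fun k => meetRank l (c k) i)
      (fun _ _ hjk => meetRank_mono (hcmono hjk) i)
      (fun k => meetRank_le_two hl _ i) j
    have h' : (meetRank l (c (j + 1)) i : ℝ) = meetRank l (c j) i +
        ((Pi.single (st 1 (some i)) (1 : ℝ) : ℕ → ℝ) (j + 1) +
          (Pi.single (st 2 (some i)) (1 : ℝ) : ℕ → ℝ) (j + 1)) := by
      simp only [Pi.single_apply, st, Option.elim_some, eq_comm (a := j + 1)]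
      rw [h]
      push_cast
      rfl
    rw [h']
    simp only [extendZeroSum]
    ring
  have hzero : ∀ x : Fin m → ℝ, boundary (st 1) (st 2) (extendZeroSum x) 0 =
      -∑ u ∈ Finset.range n, boundary (st 1) (st 2) (extendZeroSum x) (u + 1) := fun x =>
    boundary_eq_zero_iff_of_sum_eq_zero _ _ (hst 1 le_rfl) (hst 2 one_le_two) (sum_extendZeroSum x)
  have hyint : ∀ u, ∃ k : ℤ, boundary (st 1) (st 2) (extendZeroSum y) (u + 1) = k := by
    intro u
    have h1 : ∑ i, y i * meetRank l (c (u + 1)) i = finrank K (c (u + 1)) := hcT _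
    have h2 : ∑ i, y i * meetRank l (c u) i = finrank K (c u) := hcT _
    refine ⟨(finrank K (c (u + 1)) : ℤ) - finrank K (c u), ?_⟩
    rw [hstep, h1, h2]
    push_cast
    rfl
  refine ⟨st 1, st 2, fun x hx => ?_, ?_, fun x hx => ?_⟩
  · rw [isFlatDirection_iff]
    constructor
    · rintro ⟨-, h⟩
      have h1 : ∀ u, boundary (st 1) (st 2) (extendZeroSum x) (u + 1) = 0 := fun u => by
        rw [hstep, h _ (hcT _), h _ (hcT _), sub_zero]
      ext u
      rcases u with _ | u
      · rw [hzero, Finset.sum_eq_zero fun u _ => h1 u, neg_zero, Pi.zero_apply]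
      · exact h1 u
    · intro h
      refine ⟨hx, fun U hU => ?_⟩
      have hcx : ∀ j, ∑ i, x i * (meetRank l (c j) i : ℝ) = 0 := by
        intro j
        induction j with
        | zero => simp [hc0, meetRank_bot]
        | succ j ih =>
          have := hstep x j
          rw [h, ih, Pi.zero_apply, sub_zero] at this
          exact this.symm
      -- The equation of an arbitrary tight `U` follows by climbing the chain. Maximality makes `(U
      -- ⊓ c (j + 1)) ⊔ c j` a member of the chain, and modularity expresses the equation of `U ⊓ c
      -- (j + 1)` through known ones.
      have key : ∀ j, ∑ i, x i * (meetRank l (U ⊓ c j) i : ℝ) = 0 := by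
        intro j
        induction j with
        | zero => simp [hc0, meetRank_bot]
        | succ j ih =>
          have hA : IsTight l y (U ⊓ c (j + 1)) := (IsTight.uncross hy hU (hcT _)).2.1
          obtain ⟨h1, -, h3⟩ := IsTight.uncross hy hA (hcT j)
          have h4 : (U ⊓ c (j + 1)) ⊓ c j = U ⊓ c j := by
            rw [inf_assoc, inf_eq_right.2 (hcmono j.le_succ)]
          have h5 : ∑ i, x i * (meetRank l ((U ⊓ c (j + 1)) ⊔ c j) i : ℝ) = 0 := by
            rcases hcmax j _ h1 le_sup_right (sup_le inf_le_right (hcmono j.le_succ)) with h6 | h6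
            · rw [h6, hcx]
            · rw [h6, hcx]
          rw [h4] at h3
          have h7 : ∑ i, x i * (meetRank l (U ⊓ c (j + 1)) i : ℝ) + ∑ i, x i * (meetRank l (c j) i : ℝ) =
              ∑ i, x i * (meetRank l ((U ⊓ c (j + 1)) ⊔ c j) i : ℝ) +
                ∑ i, x i * (meetRank l (U ⊓ c j) i : ℝ) := by
            rw [← Finset.sum_add_distrib, ← Finset.sum_add_distrib]
            refine Finset.sum_congr rfl fun i _ => ?_
            by_cases hi : y i = 0
            · simp [hx i hi]
            · rw [← mul_add, ← mul_add]
              congr 1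
              exact_mod_cast h3 i hi
          rw [hcx, h5, ih] at h7
          linarith
      have := key n
      rwa [inf_eq_left.2 (hctop n U hU le_rfl)] at this
  · rintro (_ | u)
    · choose k hk using hyint
      refine ⟨-∑ u ∈ Finset.range n, k u, ?_⟩
      rw [hzero, Finset.sum_congr rfl fun u _ => hk u]
      push_cast
      rfl
    · exact hyint u
  · have h := sum_boundary (st 1) (st 2) (hst 1 le_rfl) (hst 2 one_le_two) x
    rw [hx] at h
    have h1 : ∑ e, x e = 0 := by simpa using h.symm
    rw [Fintype.sum_option] at h1
    ext e
    rcases e with _ | i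
    · simp only [extendZeroSum]
      linarith
    · rfl

end Valuation
-- Isolation: hashing by powers and doubling the minimal length in rounds.
section Isolation

open Finset

/-- Reducing the powers of a suitable base modulo a suitable prime separates few short integral
vectors from zero. -/
theorem exists_power_hash {m : ℕ} (T : Finset (Fin m → ℤ)) (hT : ∀ v ∈ T, v ≠ 0) {Q : ℕ}
    (hQ : Q ≠ 0) (hcard : #T * m ≤ Q) (habs : ∀ v ∈ T, ∀ i, |v i| ≤ Q) :
    ∃ p k : ℕ, p ≤ 2 * Q ∧ k < p ∧ ∀ v ∈ T, ∑ i, v i * ((k ^ (i : ℕ) % p : ℕ) : ℤ) ≠ 0 := by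
  classical
  -- A prime above `Q` keeps each `v` nonzero modulo `p`. Read as a polynomial, `v` has at most `m`
  -- roots, so all of `T` has fewer than `p` roots and some `k` avoids them.
  obtain ⟨p, hp, hQp, hp2⟩ := Nat.exists_prime_lt_and_le_two_mul Q hQ
  have : Fact p.Prime := ⟨hp⟩
  let f : (Fin m → ℤ) → Polynomial (ZMod p) := fun v =>
    ∑ i, Polynomial.C (v i : ZMod p) * Polynomial.X ^ (i : ℕ)
  have hcoeff : ∀ v (i : Fin m), (f v).coeff i = (v i : ZMod p) := by
    intro v i
    simp only [f, Polynomial.finsetSum_coeff, Polynomial.coeff_C_mul_X_pow]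
    rw [sum_eq_single i]
    · simp
    · intro j _ hj
      rw [if_neg]
      exact fun h => hj (Fin.ext h.symm)
    · simp
  have hf0 : ∀ v ∈ T, f v ≠ 0 := by
    intro v hv h0
    obtain ⟨i, hi⟩ := Function.ne_iff.1 (hT v hv)
    have h1 := hcoeff v i
    rw [h0, Polynomial.coeff_zero, eq_comm, ZMod.intCast_zmod_eq_zero_iff_dvd] at h1
    have h2 := habs v hv i
    have h3 : (p : ℤ) ≤ |v i| := Int.le_of_dvd (abs_pos.2 hi) ((dvd_abs _ _).2 h1)
    have : (p : ℤ) ≤ Q := h3.trans h2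
    omega
  have hdeg : ∀ v, (f v).natDegree ≤ m := by
    intro v
    refine Polynomial.natDegree_sum_le_of_forall_le _ _ fun i _ => ?_
    exact (Polynomial.natDegree_C_mul_X_pow_le _ _).trans i.2.le
  obtain ⟨k, hk⟩ : ∃ k : ZMod p, ∀ v ∈ T, (f v).eval k ≠ 0 := by
    by_contra hcon
    push Not at hcon
    have hsub : (univ : Finset (ZMod p)) ⊆ T.biUnion fun v => (f v).roots.toFinset := by
      intro k _
      obtain ⟨v, hv, hvk⟩ := hcon k
      exact mem_biUnion.2 ⟨v, hv, Multiset.mem_toFinset.2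
        ((Polynomial.mem_roots (hf0 v hv)).2 hvk)⟩
    have h1 := card_le_card hsub
    rw [card_univ, ZMod.card] at h1
    have h2 : #(T.biUnion fun v => (f v).roots.toFinset) ≤ #T * m :=
      card_biUnion_le_card_mul _ _ _ fun v _ =>
        (Multiset.toFinset_card_le _).trans ((Polynomial.card_roots' _).trans (hdeg v))
    omega
  refine ⟨p, k.val, hp2, ZMod.val_lt k, fun v hv h0 => hk v hv ?_⟩
  have h1 := congr_arg (Int.cast : ℤ → ZMod p) h0
  push_cast at h1
  simpa [f, Polynomial.eval_finsetSum] using h1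

/-- The weight of coordinate `i` that is encoded by the digits `d` in base `B`. -/
def digitWeight (B d i : ℕ) : ℕ := (d / B % B) ^ i % (d % B + 1)

/-- The combination of the weights that are encoded by the first `r` digits of `j` in base
`B ^ 2`. -/
def roundWeight (B j i : ℕ) : ℕ → ℕ
  | 0 => 0
  | r + 1 => roundWeight B j i r * B + digitWeight B (j / (B ^ 2) ^ r) i

theorem digitWeight_add_mul (B d e i : ℕ) : digitWeight B (d + B ^ 2 * e) i = digitWeight B d i := by
  rcases Nat.eq_zero_or_pos B with rfl | hB
  · simp
  · have h1 : d + B ^ 2 * e = d + B * (B * e) := by ring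
    rw [digitWeight, h1, Nat.add_mul_mod_self_left, Nat.add_mul_div_left _ _ hB,
      Nat.add_mul_mod_self_left, digitWeight]

/-- The first rounds read only low digits of the index, so the digits of a new round can be chosen
without changing earlier rounds. -/
theorem roundWeight_add_mul {B : ℕ} (hB : 0 < B) (j e i r s : ℕ) (h : s ≤ r) :
    roundWeight B (j + (B ^ 2) ^ r * e) i s = roundWeight B j i s := by
  induction s with
  | zero => rfl
  | succ s ih =>
    obtain ⟨t, rfl⟩ : ∃ t, r = s + 1 + t := Nat.exists_eq_add_of_le h
    have h1 : (B ^ 2) ^ (s + 1 + t) * e = (B ^ 2) ^ s * (B ^ 2 * ((B ^ 2) ^ t * e)) := by ring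
    rw [roundWeight, ih (by omega), roundWeight, h1,
      Nat.add_mul_div_left _ _ (Nat.pow_pos (Nat.pow_pos hB)), digitWeight_add_mul]

theorem roundWeight_lt {B : ℕ} (hB : 0 < B) (j i r : ℕ) : roundWeight B j i r < B ^ r := by
  induction r with
  | zero => simp [roundWeight]
  | succ r ih =>
    have h1 : digitWeight B (j / (B ^ 2) ^ r) i < B :=
      (Nat.mod_lt _ (Nat.succ_pos _)).trans_le (Nat.mod_lt _ hB)
    calc roundWeight B j i r * B + digitWeight B (j / (B ^ 2) ^ r) i
        < (roundWeight B j i r + 1) * B := by rw [Nat.succ_mul]; omega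
      _ ≤ B ^ r * B := Nat.mul_le_mul_right _ ih
      _ = B ^ (r + 1) := (pow_succ B r).symm

theorem boundary_intCast {E V : Type*} [Fintype E] [DecidableEq V] (a b : E → V) (v : E → ℤ) (u : V) :
    boundary a b (fun e => (v e : ℝ)) u = (boundary a b v u : ℤ) := by
  simp only [boundary]
  push_cast
  refine sum_congr rfl fun e _ => ?_
  simp only [Pi.single_apply]
  split_ifs <;> simp

theorem extendZeroSum_intCast {m : ℕ} (v : Fin m → ℤ) :
    extendZeroSum (fun i => (v i : ℝ)) = fun e => ((extendZeroSum v e : ℤ) : ℝ) := by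
  ext e
  rcases e with _ | i <;> simp [extendZeroSum]

theorem extendZeroSum_ne_zero {m : ℕ} {R : Type*} [Ring R] {v : Fin m → R} (hv : v ≠ 0) :
    extendZeroSum v ≠ 0 := fun h => hv (funext fun i => congr_fun h (some i))

variable {K : Type*} [Field K] {n m : ℕ} {l : Fin m → Submodule K (Fin n → K)}

/-- The integral flat directions at `y` are the integral kernel of a multigraph. -/
theorem exists_int_multigraph (hl : ∀ i, Module.finrank K (l i) = 2) {y : Fin m → ℝ}
    (hy : y ∈ fractionalMatroidMatchingPolytope l) :
    ∃ a b : Option (Fin m) → ℕ,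
      (∀ u, ∃ k : ℤ, boundary a b (extendZeroSum y) u = k) ∧
      (∀ x : Fin m → ℝ, IsFlatDirection (matchingConstraints l) y x →
        boundary a b (extendZeroSum x) = 0) ∧
      (∀ v : Option (Fin m) → ℤ, (∀ i, y i = 0 → v (some i) = 0) → boundary a b v = 0 →
        v = extendZeroSum (fun i => v (some i)) ∧
        IsFlatDirection (matchingConstraints l) y fun i => (v (some i) : ℝ)) ∧
      ∀ v : Fin m → ℤ, IsFlatDirection (matchingConstraints l) y (fun i => (v i : ℝ)) →
        boundary a b (extendZeroSum v) = 0 := by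
  obtain ⟨a, b, h1, h2, h3⟩ := exists_multigraph hl hy
  refine ⟨a, b, h2, fun x hx => (h1 x (isFlatDirection_iff.1 hx).1).1 hx, fun v hv hv0 => ?_,
    fun v hv => ?_⟩
  · have h4 : boundary a b (fun e => (v e : ℝ)) = 0 := by
      ext u
      rw [boundary_intCast, hv0]
      simp
    have h5 := h3 _ h4
    have h6 : v = extendZeroSum (fun i => v (some i)) := by
      rw [extendZeroSum_intCast fun i => v (some i)] at h5
      ext e
      exact_mod_cast congr_fun h5 e
    refine ⟨h6, (h1 _ fun i hi => by simp [hv i hi]).2 ?_⟩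
    rw [← h5, h4]
  · have h4 := (h1 _ (isFlatDirection_iff.1 hv).1).1 hv
    rw [extendZeroSum_intCast] at h4
    ext u
    have := congr_fun h4 u
    rw [boundary_intCast, Pi.zero_apply] at this
    exact_mod_cast this

/-- The extreme points of the fractional matroid matching polytope are half-integral. -/
theorem half_integral_of_mem_extremePoints (hl : ∀ i, Module.finrank K (l i) = 2) {y : Fin m → ℝ}
    (hy : y ∈ (fractionalMatroidMatchingPolytope l).extremePoints ℝ) (i : Fin m) :
    ∃ k : ℤ, 2 * y i = k := by
  obtain ⟨a, b, h1, -, h3, -⟩ := exists_int_multigraph hl hy.1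
  -- `S` is the support of `y` together with the additional edge. Integral kernel vectors on it are
  -- flat directions and hence vanish at an extreme point.
  refine half_integral_of_int_kernel_eq_zero a b (S := {e | ∀ i, e = some i → y i ≠ 0})
    (y := extendZeroSum y) (fun v hv hv0 => ?_) (fun e he => ?_) h1 (some i)
  · have hsupp : ∀ i, y i = 0 → v (some i) = 0 := fun i hi => hv _ fun h => h i rfl hi
    obtain ⟨h4, h5⟩ := h3 v hsupp hv0
    rw [← polyhedron_matchingConstraints] at hy
    have h6 := h5.eq_zero_of_mem_extremePoints (finite_matchingConstraints hl) hy
    have h7 : (fun i => v (some i)) = 0 := by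
      ext i
      have := congr_fun h6 i
      rw [Pi.zero_apply] at this
      exact_mod_cast this
    rw [h4, h7]
    ext e
    rcases e with _ | i <;> simp [extendZeroSum]
  · simp only [Set.mem_ofPred_eq, not_forall, not_not] at he
    obtain ⟨i, rfl, hi⟩ := he
    exact hi

/-- A nonzero flat direction yields a short integral one. -/
theorem exists_short_flat (hl : ∀ i, Module.finrank K (l i) = 2) {y x : Fin m → ℝ}
    (hy : y ∈ fractionalMatroidMatchingPolytope l)
    (hx : IsFlatDirection (matchingConstraints l) y x) (hx0 : x ≠ 0) :
    ∃ v : Fin m → ℤ, v ≠ 0 ∧ IsFlatDirection (matchingConstraints l) y (fun i => (v i : ℝ)) ∧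
      ∑ e, |extendZeroSum v e| ≤ 2 * (m + 1) := by
  obtain ⟨a, b, -, h2, h3, -⟩ := exists_int_multigraph hl hy
  obtain ⟨v, hv0, hvb, hvs, hvn⟩ := exists_short_int_kernel a b (h2 x hx) (extendZeroSum_ne_zero hx0)
  obtain ⟨h4, h5⟩ := h3 v (fun i hi => hvs _ ((isFlatDirection_iff.1 hx).1 i hi)) hvb
  refine ⟨fun i => v (some i), fun h => hv0 ?_, h5, ?_⟩
  · rw [h4, h]
    ext e
    rcases e with _ | i <;> simp [extendZeroSum]
  · rw [← h4]
    simpa using hvn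

/-- The number of near-shortest integral flat directions is polynomially bounded. -/
theorem exists_near_shortest_flat (hl : ∀ i, Module.finrank K (l i) = 2) {y : Fin m → ℝ}
    (hy : y ∈ fractionalMatroidMatchingPolytope l) {r : ℤ}
    (hr : ∀ v : Fin m → ℤ, v ≠ 0 → IsFlatDirection (matchingConstraints l) y (fun i => (v i : ℝ)) →
      r ≤ ∑ e, |extendZeroSum v e|) :
    ∃ T : Finset (Fin m → ℤ), #T ≤ (16 * (m + 1) ^ 2) ^ 4 * (2 * (m + 1) + 1) ^ 3 ∧
      (∀ v ∈ T, v ≠ 0 ∧ ∑ e, |extendZeroSum v e| < 2 * r) ∧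
      ∀ v : Fin m → ℤ, v ≠ 0 → IsFlatDirection (matchingConstraints l) y (fun i => (v i : ℝ)) →
        v ∉ T → 2 * r ≤ ∑ e, |extendZeroSum v e| := by
  obtain ⟨a, b, -, -, h3, h4⟩ := exists_int_multigraph hl hy
  set S : Set (Option (Fin m)) := {e | ∀ i, e = some i → y i ≠ 0} with hS
  have hS' : ∀ v : Option (Fin m) → ℤ, (∀ e ∉ S, v e = 0) ↔ ∀ i, y i = 0 → v (some i) = 0 := by
    intro v
    refine ⟨fun h i hi => h _ fun h' => h' i rfl hi, fun h e he => ?_⟩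
    simp only [hS, Set.mem_ofPred_eq, not_forall, not_not] at he
    obtain ⟨i, rfl, hi⟩ := he
    exact h i hi
  have hzero : extendZeroSum (0 : Fin m → ℤ) = 0 := by
    ext e
    rcases e with _ | i <;> simp [extendZeroSum]
  obtain ⟨T, hT, hmem⟩ := exists_card_near_shortest_le a b (S := S) (r := r) (by
    intro v hv hv0 hne
    obtain ⟨h5, h6⟩ := h3 v ((hS' v).1 hv) hv0
    rw [h5]
    refine hr _ (fun h => hne ?_) h6
    rw [h5, h, hzero])
  rw [Fintype.card_option, Fintype.card_fin] at hT
  refine ⟨T.image fun v i => v (some i), card_image_le.trans hT, ?_, ?_⟩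
  · intro v hv
    obtain ⟨v', hv', rfl⟩ := mem_image.1 hv
    obtain ⟨h5, h6, h7, h8⟩ := (hmem v').1 hv'
    obtain ⟨h9, -⟩ := h3 v' ((hS' v').1 h5) h6
    refine ⟨fun h => h7 ?_, ?_⟩
    · rw [h9, h, hzero]
    · rwa [← h9]
  · intro v hv hflat hvT
    by_contra hlt
    push Not at hlt
    refine hvT (mem_image.2 ⟨extendZeroSum v, (hmem _).2 ⟨(hS' _).2 fun i hi => ?_, h4 v hflat,
      extendZeroSum_ne_zero hv, hlt⟩, rfl⟩)
    have := (isFlatDirection_iff.1 hflat).1 i hi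
    simpa [extendZeroSum] using this

/-- Passing to a smaller face can only add tight inequalities, so no new flat direction arises. -/
theorem IsFlatDirection.of_tight {ι : Type*} [Fintype ι] {C : Set ((ι → ℝ) × ℝ)} {y z x : ι → ℝ}
    (h : ∀ c ∈ C, c.1 ⬝ᵥ y = c.2 → c.1 ⬝ᵥ z = c.2) (hx : IsFlatDirection C z x) :
    IsFlatDirection C y x := fun c hc hy => hx c hc (h c hc hy)

/-- Some choice of the digits of the first `r` rounds doubles the length of the shortest integral
flat direction of the face of maximizers in every round. -/
theorem exists_rounds (hl : ∀ i, Module.finrank K (l i) = 2) {B Q R : ℕ}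
    (hQ : (16 * (m + 1) ^ 2) ^ 4 * (2 * (m + 1) + 1) ^ 3 * m ≤ Q) (hQR : 2 ^ R ≤ Q)
    (hB : 4 * Q * (m + 1) < B) (r : ℕ) (hrR : r ≤ R) :
    ∃ j < (B ^ 2) ^ r,
      ∃ y ∈ maxFace (fun i : Fin m => (roundWeight B j i r : ℝ)) (fractionalMatroidMatchingPolytope l),
        (∀ z ∈ maxFace (fun i : Fin m => (roundWeight B j i r : ℝ))
          (fractionalMatroidMatchingPolytope l),
          ∀ c ∈ matchingConstraints l, c.1 ⬝ᵥ y = c.2 → c.1 ⬝ᵥ z = c.2) ∧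
        ∀ v : Fin m → ℤ, v ≠ 0 →
          IsFlatDirection (matchingConstraints l) y (fun i => (v i : ℝ)) →
          2 ^ r ≤ ∑ e, |extendZeroSum v e| := by
  have hB0 : 0 < B := by omega
  have hP := isCompact_matchingPolytope hl
  have hfin := finite_matchingConstraints hl
  have hmin : ∀ w : Fin m → ℝ, ∃ y ∈ maxFace w (fractionalMatroidMatchingPolytope l),
      ∀ z ∈ maxFace w (fractionalMatroidMatchingPolytope l),
        ∀ c ∈ matchingConstraints l, c.1 ⬝ᵥ y = c.2 → c.1 ⬝ᵥ z = c.2 := by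
    intro w
    refine exists_tight_minimal hfin ?_ (maxFace_nonempty hP matchingPolytope_nonempty w) ?_
    · refine (isExposed_maxFace w _).convex ?_
      rw [← polyhedron_matchingConstraints]
      exact convex_polyhedron _
    · rw [polyhedron_matchingConstraints]
      exact fun y hy => hy.1
  induction r with
  | zero =>
    obtain ⟨y, hy, hmin⟩ := hmin fun i : Fin m => (roundWeight B 0 i 0 : ℝ)
    refine ⟨0, by simp, y, hy, hmin, fun v hv _ => ?_⟩
    obtain ⟨e, he⟩ := Function.ne_iff.1 (extendZeroSum_ne_zero hv)
    have h1 : 1 ≤ |extendZeroSum v e| := Int.one_le_abs he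
    exact h1.trans (single_le_sum (f := fun e => |extendZeroSum v e|) (fun _ _ => abs_nonneg _)
      (mem_univ e))
  | succ r ih =>
    obtain ⟨j, hj, y, hy, hymin, hshort⟩ := ih (by omega)
    obtain ⟨T, hTcard, hT, hTc⟩ := exists_near_shortest_flat hl hy.1 hshort
    have hpow : (2 : ℤ) * 2 ^ r ≤ Q := by
      have h1 : 2 ^ (r + 1) ≤ 2 ^ R := Nat.pow_le_pow_right two_pos hrR
      have h2 : (2 : ℤ) * 2 ^ r = ((2 ^ (r + 1) : ℕ) : ℤ) := by push_cast; ring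
      rw [h2]
      exact_mod_cast h1.trans hQR
    have hQ0 : Q ≠ 0 := by
      have : 0 < 2 ^ R := by positivity
      omega
    obtain ⟨p, k, hp, hk, hpk⟩ := exists_power_hash T (fun v hv => (hT v hv).1) hQ0
      ((Nat.mul_le_mul_right m hTcard).trans hQ) (fun v hv i => by
        have h1 := (hT v hv).2
        have h2 : |v i| ≤ ∑ e, |extendZeroSum v e| :=
          single_le_sum (f := fun e => |extendZeroSum v e|) (fun _ _ => abs_nonneg _)
            (mem_univ (some i))
        omega)
    have hpB : p ≤ B := by nlinarith
    -- The two new digits are `p - 1` and `k`. Storing the modulus minus one makes every digit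
    -- decode to a positive modulus.
    let d := p - 1 + B * k
    let j' := j + (B ^ 2) ^ r * d
    have hd : d < B ^ 2 := by
      have h1 : B * k + B ≤ B * B := by
        rw [← Nat.mul_succ]
        exact Nat.mul_le_mul_left _ (by omega)
      rw [pow_two]
      simp only [d]
      omega
    have hdw : ∀ i, digitWeight B (j' / (B ^ 2) ^ r) i = k ^ i % p := by
      intro i
      have h1 : j' / (B ^ 2) ^ r = d := by
        simp only [j']
        rw [Nat.add_mul_div_left _ _ (by positivity), Nat.div_eq_of_lt hj, zero_add]
      rw [h1, digitWeight]
      simp only [d]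
      rw [Nat.add_mul_mod_self_left, Nat.add_mul_div_left _ _ hB0, Nat.div_eq_of_lt (by omega),
        zero_add, Nat.mod_eq_of_lt (by omega : k < B), Nat.mod_eq_of_lt (by omega : p - 1 < B),
        Nat.sub_add_cancel (by omega)]
    have hweight : (fun i : Fin m => (roundWeight B j' i (r + 1) : ℝ)) =
        fun i : Fin m => (roundWeight B j i r : ℝ) * B + ((k ^ (i : ℕ) % p : ℕ) : ℝ) := by
      ext i
      rw [roundWeight, hdw, roundWeight_add_mul hB0 _ _ _ _ _ le_rfl]
      push_cast
      rfl
    obtain ⟨y', hy', hymin'⟩ := hmin fun i : Fin m => (roundWeight B j' i (r + 1) : ℝ)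
    refine ⟨j', ?_, y', hy', hymin', fun v hv hflat => ?_⟩
    · have h1 : (B ^ 2) ^ r * d + (B ^ 2) ^ r ≤ (B ^ 2) ^ r * B ^ 2 := by
        rw [← Nat.mul_succ]
        exact Nat.mul_le_mul_left _ hd
      rw [pow_succ]
      simp only [j']
      omega
    · have hsub : maxFace (fun i : Fin m => (roundWeight B j' i (r + 1) : ℝ))
          (fractionalMatroidMatchingPolytope l) ⊆ maxFace (fun i : Fin m => (roundWeight B j i r : ℝ))
          (fractionalMatroidMatchingPolytope l) := by
        rw [hweight]
        refine maxFace_subset_of_half_integral (W := fun i : Fin m => roundWeight B j i r)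
          (w := fun i : Fin m => k ^ (i : ℕ) % p) (c := p) hP matchingPolytope_nonempty
          (fun y hy i => ⟨hy.1 i, le_one_of_mem_matchingPolytope hl hy i⟩)
          (fun y hy i => half_integral_of_mem_extremePoints hl hy i)
          (fun i => (Nat.mod_lt _ (by omega)).le) ?_
        rw [Fintype.card_fin]
        nlinarith
      -- A direction flat at `y'` is flat at `y` too, so the old and the new objective both vanish
      -- on it, and with them the added weight. The hash excludes this for vectors in `T`, so `v`
      -- has at least twice the old minimal length.
      have hflat' := IsFlatDirection.of_tight (hymin y' (hsub hy')) hflat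
      rw [pow_succ']
      refine hTc v hv hflat' fun hvT => hpk v hvT ?_
      rw [← polyhedron_matchingConstraints] at hy' hy
      have h1 := hflat.dotProduct_eq_zero hfin hy'
      have h2 := hflat'.dotProduct_eq_zero hfin hy
      rw [hweight] at h1
      have h3 : (∑ i, (v i : ℝ) * ((k ^ (i : ℕ) % p : ℕ) : ℝ)) = 0 := by
        have h4 : (∑ i, (v i : ℝ) * ((k ^ (i : ℕ) % p : ℕ) : ℝ)) =
            (∑ i : Fin m, ((roundWeight B j i r : ℝ) * B + ((k ^ (i : ℕ) % p : ℕ) : ℝ)) * v i) -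
              B * ∑ i : Fin m, (roundWeight B j i r : ℝ) * v i := by
          rw [mul_sum, ← sum_sub_distrib]
          exact sum_congr rfl fun i _ => by ring
        rw [h4]
        simp only [dotProduct] at h1 h2
        rw [h1, h2, mul_zero, sub_zero]
      have h5 : ((∑ i, v i * ((k ^ (i : ℕ) % p : ℕ) : ℤ) : ℤ) : ℝ) = 0 := by
        rw [Int.cast_sum, ← h3]
        exact sum_congr rfl fun i _ => by rw [Int.cast_mul, Int.cast_natCast]
      exact Int.cast_eq_zero.1 h5

/-- Some choice of the digits yields isolating weights. -/
theorem exists_isolating_roundWeight (hl : ∀ i, Module.finrank K (l i) = 2) {B Q R : ℕ}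
    (hQ : (16 * (m + 1) ^ 2) ^ 4 * (2 * (m + 1) + 1) ^ 3 * m ≤ Q) (hQR : 2 ^ R ≤ Q)
    (hB : 4 * Q * (m + 1) < B) (hR : 2 * (m + 1) < 2 ^ R) :
    ∃ j < (B ^ 2) ^ R,
      IsIsolating (fun i : Fin m => roundWeight B j i R) (fractionalMatroidMatchingPolytope l) := by
  obtain ⟨j, hj, y, hy, hymin, hshort⟩ := exists_rounds hl hQ hQR hB R le_rfl
  refine ⟨j, hj, y, ⟨hy.1, hy.2⟩, fun z hz => ?_⟩
  by_contra hne
  have hz' : z ∈ maxFace (fun i : Fin m => (roundWeight B j i R : ℝ))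
    (fractionalMatroidMatchingPolytope l) := ⟨hz.1, hz.2⟩
  -- A second maximizer would give a flat direction and so an integral one of length at most `2 * (m
  -- + 1)`, below the bound `2 ^ R` reached after all rounds.
  have hflat : IsFlatDirection (matchingConstraints l) y (z - y) := by
    intro c hc hcy
    rw [dotProduct_sub, hymin z hz' c hc hcy, hcy, sub_self]
  obtain ⟨v, hv0, hv, hvn⟩ := exists_short_flat hl hy.1 hflat (sub_ne_zero.2 hne)
  have h1 := (hshort v hv0 hv).trans hvn
  have h2 : (2 : ℤ) * (m + 1) < 2 ^ R := by exact_mod_cast hR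
  omega

end Isolation
-- Structured programs and their execution on the machine.
namespace PRAM

/-- A structured program: straight-line code and loops that run until a register is zero. -/
inductive Cmd where
  | block (is : List Instr)
  | seq (c d : Cmd)
  | loop (r : ℕ) (c : Cmd)

/-- The number of instructions of the compiled program. -/
def Cmd.size : Cmd → ℕ
  | .block is => is.length
  | .seq c d => c.size + d.size
  | .loop _ c => c.size + 2

/-- The machine code, placed at address `o`. -/
def Cmd.compile (o : ℕ) : Cmd → Program
  | .block is => is
  | .seq c d => c.compile o ++ d.compile (o + c.size)
  | .loop r c => .jumpZero r (o + c.size + 2) :: (c.compile (o + 1) ++ [.jump o])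

theorem Cmd.length_compile (c : Cmd) (o : ℕ) : (c.compile o).length = c.size := by
  induction c generalizing o with
  | block is => rfl
  | seq c d hc hd => simp [compile, size, hc, hd]
  | loop r c hc => simp [compile, size, hc]

/-- The registers after an assignment without overflow. -/
def Instr.assigned (mem s : ℕ → ℕ) : Instr → ℕ → ℕ
  | .const r v => Function.update s r v
  | .arith op r x y => Function.update s r (op.eval (s x) (s y))
  | .load r x => Function.update s r (mem (s x))
  | _ => s

/-- The instruction is an assignment of a value that fits into a word. -/
def Instr.Fits (b : ℕ) (mem s : ℕ → ℕ) : Instr → Prop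
  | .const _ v => v < 2 ^ b
  | .arith op _ x y => op.eval (s x) (s y) < 2 ^ b
  | .load _ x => mem (s x) < 2 ^ b
  | _ => False

/-- The registers after straight-line code without overflow. -/
def blockResult (mem s : ℕ → ℕ) : List Instr → ℕ → ℕ
  | [] => s
  | i :: is => blockResult mem (i.assigned mem s) is

/-- No overflow occurs in straight-line code. -/
def BlockFits (b : ℕ) (mem s : ℕ → ℕ) : List Instr → Prop
  | [] => True
  | i :: is => i.Fits b mem s ∧ BlockFits b mem (i.assigned mem s) is

/-- The structured program takes the registers `s` to `s'` in a given number of steps. -/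
inductive Runs (b : ℕ) (mem : ℕ → ℕ) : Cmd → (ℕ → ℕ) → ℕ → (ℕ → ℕ) → Prop
  | block {is : List Instr} {s : ℕ → ℕ} (h : BlockFits b mem s is) :
      Runs b mem (.block is) s is.length (blockResult mem s is)
  | seq {c d : Cmd} {s s' s'' : ℕ → ℕ} {k k' : ℕ} (h : Runs b mem c s k s')
      (h' : Runs b mem d s' k' s'') : Runs b mem (.seq c d) s (k + k') s''
  | loopZero {r : ℕ} {c : Cmd} {s : ℕ → ℕ} (h : s r = 0) : Runs b mem (.loop r c) s 1 s
  -- The two additional steps are the test at the head of the loop and the jump back.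
  | loopSucc {r : ℕ} {c : Cmd} {s s' s'' : ℕ → ℕ} {k k' : ℕ} (h0 : s r ≠ 0) (h : Runs b mem c s k s')
      (h' : Runs b mem (.loop r c) s' k' s'') : Runs b mem (.loop r c) s (k + k' + 2) s''

theorem Runs.congr_steps {b : ℕ} {mem : ℕ → ℕ} {c : Cmd} {s s' : ℕ → ℕ} {k k' : ℕ}
    (h : Runs b mem c s k s') (hk : k = k') : Runs b mem c s k' s' := hk ▸ h

/-- A processor takes a number of steps without writing to the memory. -/
inductive QuietSteps (prog : Program) (b : ℕ) (mem : ℕ → ℕ) : ℕ → Local → Local → Prop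
  | refl (q : Local) : QuietSteps prog b mem 0 q q
  | head {k : ℕ} {q q' : Local} {i : Instr} (hi : prog[q.pc]? = some i)
      (hs : ∀ s r, i ≠ .store s r) (h : QuietSteps prog b mem k (i.exec b mem q) q') :
      QuietSteps prog b mem (k + 1) q q'

theorem QuietSteps.trans {prog : Program} {b : ℕ} {mem : ℕ → ℕ} {k k' : ℕ} {q q' q'' : Local}
    (h : QuietSteps prog b mem k q q') (h' : QuietSteps prog b mem k' q' q'') :
    QuietSteps prog b mem (k + k') q q'' := by
  induction h with
  | refl q => rwa [zero_add]
  | head hi hs _ ih =>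
    rw [Nat.add_right_comm]
    exact .head hi hs (ih h')

theorem QuietSteps.single {prog : Program} {b : ℕ} {mem : ℕ → ℕ} {q : Local} {i : Instr}
    (hi : prog[q.pc]? = some i) (hs : ∀ s r, i ≠ .store s r) :
    QuietSteps prog b mem 1 q (i.exec b mem q) :=
  .head hi hs (.refl _)

theorem Instr.Fits.exec {b : ℕ} {mem s : ℕ → ℕ} {i : Instr} (h : i.Fits b mem s) (pc : ℕ) :
    i.exec b mem ⟨pc, s⟩ = ⟨pc + 1, i.assigned mem s⟩ ∧ ∀ s r, i ≠ .store s r := by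
  cases i <;> simp_all [Instr.Fits, Instr.exec, Instr.assigned, Local.assign, Nat.mod_eq_of_lt]

theorem quietSteps_block {prog : Program} {b : ℕ} {mem : ℕ → ℕ} (is : List Instr) {pre post : Program}
    {s : ℕ → ℕ} (hprog : prog = pre ++ is ++ post) (h : BlockFits b mem s is) :
    QuietSteps prog b mem is.length ⟨pre.length, s⟩
      ⟨pre.length + is.length, blockResult mem s is⟩ := by
  induction is generalizing pre s with
  | nil => exact .refl _
  | cons i is ih =>
    obtain ⟨h1, h2⟩ := h.1.exec pre.length
    refine .head (i := i) (by simp [hprog]) h2 ?_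
    rw [h1]
    have := ih (pre := pre ++ [i]) (s := i.assigned mem s) (by simp [hprog]) h.2
    simpa [blockResult, add_assoc, add_comm, add_left_comm] using this

/-- Correctness of compilation. Jump targets are absolute, so the code is compiled for the address
`pre.length` at which it stands inside an arbitrary program. -/
theorem Runs.quietSteps {b : ℕ} {mem : ℕ → ℕ} {c : Cmd} {s s' : ℕ → ℕ} {k : ℕ}
    (h : Runs b mem c s k s') {prog pre post : Program}
    (hprog : prog = pre ++ c.compile pre.length ++ post) :
    QuietSteps prog b mem k ⟨pre.length, s⟩ ⟨pre.length + c.size, s'⟩ := by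
  induction h generalizing pre post with
  | block h => exact quietSteps_block _ hprog h
  | @seq c d s s' s'' k k' h h' ih ih' =>
    have h1 := ih (pre := pre) (post := d.compile (pre.length + c.size) ++ post)
      (by simp [hprog, Cmd.compile])
    have h2 := ih' (pre := pre ++ c.compile pre.length) (post := post)
      (by simp [hprog, Cmd.compile, Cmd.length_compile])
    simp only [List.length_append, Cmd.length_compile] at h2
    have := h1.trans h2
    rwa [add_assoc] at this
  | @loopZero r c s h =>
    have h1 := QuietSteps.single (b := b) (mem := mem) (q := ⟨pre.length, s⟩) (prog := prog)
      (i := .jumpZero r (pre.length + c.size + 2)) (by simp [hprog, Cmd.compile]) (by simp)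
    simpa [Instr.exec, h, Cmd.size, add_assoc] using h1
  | @loopSucc r c s s' s'' k k' h0 h h' ih ih' =>
    have h1 := QuietSteps.single (b := b) (mem := mem) (q := ⟨pre.length, s⟩) (prog := prog)
      (i := .jumpZero r (pre.length + c.size + 2)) (by simp [hprog, Cmd.compile]) (by simp)
    simp only [Instr.exec, h0, if_false] at h1
    have h2 := ih (pre := pre ++ [.jumpZero r (pre.length + c.size + 2)])
      (post := .jump pre.length :: post) (by simp [hprog, Cmd.compile])
    simp only [List.length_append, List.length_singleton] at h2
    have h3 := QuietSteps.single (b := b) (mem := mem) (q := ⟨pre.length + 1 + c.size, s'⟩)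
      (prog := prog) (i := .jump pre.length) (by
        rw [hprog]
        simp [Cmd.compile, Cmd.length_compile, add_assoc, add_comm 1]) (by simp)
    simp only [Instr.exec] at h3
    have h4 := ih' (pre := pre) (post := post) hprog
    have := ((h1.trans h2).trans h3).trans h4
    convert this using 1
    ring

/-- The priority rule is irrelevant when all processors that write to a cell write the same value.
-/
theorem findSome?_eq_some_of_forall {α β : Type*} {f : α → Option β} {v : β} {l : List α} {x : α}
    (hx : x ∈ l) (hfx : f x = some v) (h : ∀ y ∈ l, f y = none ∨ f y = some v) :
    l.findSome? f = some v := by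
  induction l with
  | nil => simp at hx
  | cons a l ih =>
    rw [List.findSome?_cons]
    rcases h a (by simp) with ha | ha
    · rw [ha]
      rcases List.mem_cons.1 hx with rfl | hx
      · rw [ha] at hfx
        exact absurd hfx (by simp)
      · exact ih hx fun y hy => h y (List.mem_cons_of_mem _ hy)
    · rw [ha]

/-- Without writes, the processors run independently of each other. -/
theorem iterate_step_of_quietSteps {prog : Program} {b p k : ℕ} {σ : Config p} {q : Fin p → Local}
    (h : ∀ i, QuietSteps prog b σ.mem k (σ.proc i) (q i)) :
    (step prog b)^[k] σ = ⟨q, σ.mem⟩ := by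
  induction k generalizing σ with
  | zero =>
    have : σ.proc = q := by
      ext1 i
      generalize hq : σ.proc i = q₀
      have := h i
      rw [hq] at this
      cases this
      rfl
    rw [← this]
    rfl
  | succ k ih =>
    have hstep : ∀ i, (σ.proc i).write prog = (fun _ => none) ∧
        QuietSteps prog b σ.mem k ((σ.proc i).next prog b σ.mem) (q i) := by
      intro i
      generalize hq : σ.proc i = q₀
      have := h i
      rw [hq] at this
      cases this with
      | @head _ _ _ j hi hs h =>
        refine ⟨?_, by simpa [Local.next, hi] using h⟩
        ext1 a
        cases j <;> simp_all [Local.write]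
    have hmem : (step prog b σ).mem = σ.mem := by
      ext a
      simp only [step, (hstep _).1]
      rw [List.findSome?_eq_none_iff.2 (fun _ _ => rfl)]
      rfl
    rw [Function.iterate_succ_apply, ih (σ := step prog b σ), hmem]
    intro i
    rw [hmem]
    exact (hstep i).2

/-- A step in which all processors write their register `r` to the cell in their register `s`. -/
theorem step_store {prog : Program} {b p : ℕ} {σ : Config p} {pc s r : ℕ}
    (hpc : ∀ i, (σ.proc i).pc = pc) (hprog : prog[pc]? = some (.store s r)) :
    step prog b σ = ⟨fun i => ⟨pc + 1, (σ.proc i).reg⟩, fun a => ((List.finRange p).findSome? fun i =>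
      if (σ.proc i).reg s = a then some ((σ.proc i).reg r) else none).getD (σ.mem a)⟩ := by
  have h1 : ∀ i, (σ.proc i).next prog b σ.mem = ⟨pc + 1, (σ.proc i).reg⟩ := by
    intro i
    simp [Local.next, hpc i, hprog, Instr.exec]
  have h2 : ∀ i a, (σ.proc i).write prog a =
      if (σ.proc i).reg s = a then some ((σ.proc i).reg r) else none := by
    intro i a
    simp [Local.write, hpc i, hprog]
  simp only [step, h1, h2]

/-- If all processors compute, in the same number of steps, a value and a common total, then they
can write the values to the cells given by their numbers and the total to cell `0`. -/
theorem exists_run_of_runs {c : Cmd} {b p input k : ℕ} (hp : 0 < p) (hpb : p ≤ 2 ^ b)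
    {rZero rVal rTot tot : ℕ} {val : ℕ → ℕ}
    (h : ∀ q < p, ∃ s', Runs b (Function.update (fun _ => 0) 0 (input % 2 ^ b)) c
      (Function.update (fun _ => 0) 0 q) k s' ∧
      s' 0 = q ∧ s' rZero = 0 ∧ s' rVal = val q ∧ s' rTot = tot) :
    ∃ σ : Config p,
      σ = run (c.compile 0 ++ [.store 0 rVal, .store rZero rTot]) b p input (k + 2) ∧
      σ.Halted (c.compile 0 ++ [.store 0 rVal, .store rZero rTot]) ∧ σ.mem 0 = tot ∧
      ∀ a, 0 < a → a < p → σ.mem a = val a := by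
  set prog := c.compile 0 ++ [.store 0 rVal, .store rZero rTot] with hprog
  choose s' hs' h0 hz hv ht using fun i : Fin p => h i i.2
  have hquiet : ∀ i : Fin p, QuietSteps prog b (init b p input).mem k ((init b p input).proc i)
      ⟨c.size, s' i⟩ := by
    intro i
    have h1 := (hs' i).quietSteps (prog := prog) (pre := [])
      (post := [.store 0 rVal, .store rZero rTot]) (by simp [hprog])
    have h2 : (i : ℕ) % 2 ^ b = i := Nat.mod_eq_of_lt (i.2.trans_le hpb)
    simpa [init, h2] using h1
  have hk := iterate_step_of_quietSteps hquiet
  have hp1 : prog[c.size]? = some (.store 0 rVal) := by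
    simp [hprog, ← Cmd.length_compile c 0]
  have hp2 : prog[c.size + 1]? = some (.store rZero rTot) := by
    simp [hprog, ← Cmd.length_compile c 0]
  -- After `k` steps every processor is at the first store. That store also puts a value into cell
  -- `0`, which the second store replaces by the total.
  have hrun : run prog b p input (k + 2) = step prog b (step prog b ⟨fun i => ⟨c.size, s' i⟩,
      (init b p input).mem⟩) := by
    rw [run, Function.iterate_succ_apply', Function.iterate_succ_apply', hk]
  rw [step_store (σ := ⟨fun i => ⟨c.size, s' i⟩, _⟩) (pc := c.size) (fun i => rfl) hp1,
    step_store (pc := c.size + 1) (fun i => rfl) hp2] at hrun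
  refine ⟨_, rfl, ?_, ?_, ?_⟩
  · rw [hrun]
    intro i
    simp [hprog, Cmd.length_compile]
  · rw [hrun]
    simp only
    rw [findSome?_eq_some_of_forall (x := (⟨0, hp⟩ : Fin p)) (v := tot) (List.mem_finRange _)]
    · rfl
    · simp [hz, ht]
    · intro i _
      simp [hz, ht]
  · intro a ha hap
    rw [hrun]
    simp only
    rw [List.findSome?_eq_none_iff.2]
    · rw [findSome?_eq_some_of_forall (x := (⟨a, hap⟩ : Fin p)) (v := val a) (List.mem_finRange _)]
      · rfl
      · simp [h0, hv]
      · intro i _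
        by_cases hi : (i : ℕ) = a
        · right
          simp [h0, hv, hi]
        · left
          simp [h0, hi]
    · intro i _
      simp [hz, ha.ne]

end PRAM
-- The program that computes one entry of a weight vector.
namespace PRAM

/-- Halve register `5` until it is zero, doubling register `6` and counting in register `7`. -/
def sizeLoop : Cmd :=
  .loop 5 (.block [.arith .div 5 5 4, .arith .mul 6 6 4, .arith .add 7 7 3])

/-- Modular exponentiation by repeated squaring: multiply register `16` by the power of register
`14` whose exponent has the lowest binary digits of register `15`, modulo register `13`. -/
def powerLoop : Cmd :=
  .loop 17 (.block [.arith .mod 18 15 4, .arith .div 15 15 4, .arith .sub 19 3 18,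
    .arith .mul 18 18 14, .arith .add 19 19 18, .arith .mul 16 16 19, .arith .mod 16 16 13,
    .arith .mul 14 14 14, .arith .mod 14 14 13, .arith .sub 17 17 3])

/-- The loop over the rounds: read two digits of register `9`, compute the power and add it to the
weight in register `11`; register `12` accumulates the number of weight vectors. -/
def roundLoop : Cmd :=
  .loop 8 (.seq (.block [.arith .mod 13 9 6, .arith .add 13 13 3, .arith .div 9 9 6,
      .arith .mod 14 9 6, .arith .div 9 9 6, .arith .add 15 10 1, .arith .mod 16 3 13,
      .arith .add 17 7 1])
    (.seq powerLoop (.block [.arith .mul 11 11 6, .arith .add 11 11 16, .arith .mul 12 12 20,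
      .arith .sub 8 8 3])))

/-- The computation of one entry of a weight vector. -/
def weightCmd : Cmd :=
  .seq (.block [.load 2 1, .const 3 1, .const 4 2, .arith .add 5 2 1, .arith .add 6 4 1])
    (.seq sizeLoop
      (.seq (.block [.arith .mul 6 6 6, .arith .mul 6 6 6, .arith .mul 6 6 6, .arith .mul 6 6 6,
        .arith .mul 6 6 6, .arith .mul 6 6 6, .arith .add 8 7 4, .arith .sub 9 0 3,
        .arith .mod 10 9 2, .arith .div 9 9 2, .const 12 1, .arith .mul 20 6 6]) roundLoop))

theorem size_eq_succ_size_half {x : ℕ} (hx : x ≠ 0) : Nat.size x = Nat.size (x / 2) + 1 := by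
  have h := Nat.size_bit (b := x.bodd) (n := x.div2) (by rwa [Nat.bit_bodd_div2])
  rwa [Nat.bit_bodd_div2, Nat.div2_val] at h

theorem runs_sizeLoop {b : ℕ} {mem : ℕ → ℕ} (k : ℕ) :
    ∀ s : ℕ → ℕ, Nat.size (s 5) = k → s 3 = 1 → s 4 = 2 → s 6 * 2 ^ k < 2 ^ b → s 5 < 2 ^ b →
      s 7 + k < 2 ^ b → ∃ s', Runs b mem sizeLoop s (5 * k + 1) s' ∧ s' 6 = s 6 * 2 ^ k ∧
        s' 7 = s 7 + k ∧ ∀ r, r ≠ 5 → r ≠ 6 → r ≠ 7 → s' r = s r := by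
  induction k with
  | zero =>
    intro s h5 _ _ _ _ _
    exact ⟨s, .loopZero (Nat.size_eq_zero.1 h5), by simp, by simp, fun _ _ _ _ => rfl⟩
  | succ k ih =>
    intro s h5 h3 h4 h6 h5b h7
    have hx : s 5 ≠ 0 := by
      intro h
      rw [h, Nat.size_zero] at h5
      omega
    rw [size_eq_succ_size_half hx] at h5
    have hfit : BlockFits b mem s [.arith .div 5 5 4, .arith .mul 6 6 4, .arith .add 7 7 3] := by
      have h1 : s 6 * 2 ≤ s 6 * 2 ^ (k + 1) :=
        Nat.mul_le_mul_left _ (by rw [pow_succ]; have := Nat.one_le_two_pow (n := k); omega)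
      simp [BlockFits, Instr.Fits, Instr.assigned, BinOp.eval, h3, h4]
      omega
    set s₁ := blockResult mem s [.arith .div 5 5 4, .arith .mul 6 6 4, .arith .add 7 7 3] with hs₁
    have e5 : s₁ 5 = s 5 / 2 := by simp [hs₁, blockResult, Instr.assigned, BinOp.eval, h4]
    have e6 : s₁ 6 = s 6 * 2 := by simp [hs₁, blockResult, Instr.assigned, BinOp.eval, h4]
    have e7 : s₁ 7 = s 7 + 1 := by simp [hs₁, blockResult, Instr.assigned, BinOp.eval, h3]
    have er : ∀ r, r ≠ 5 → r ≠ 6 → r ≠ 7 → s₁ r = s r := fun r h h' h'' => by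
      simp [hs₁, blockResult, Instr.assigned, h, h', h'']
    have h2 : s 6 * 2 * 2 ^ k = s 6 * 2 ^ (k + 1) := by ring
    obtain ⟨s', hr, g6, g7, gr⟩ := ih s₁ (by rw [e5]; omega) (by rw [er] <;> simp [h3])
      (by rw [er] <;> simp [h4]) (by rw [e6, h2]; exact h6) (by rw [e5]; omega) (by rw [e7]; omega)
    refine ⟨s', ?_, by rw [g6, e6, h2], by rw [g7, e7]; omega,
      fun r h h' h'' => (gr r h h' h'').trans (er r h h' h'')⟩
    have := Runs.loopSucc hx (.block hfit) hr
    exact this.congr_steps (by simp only [List.length_cons, List.length_nil]; ring)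

/-- Loop invariant: with `k` binary digits left, register `16` times the power of register `14` with
the remaining exponent is constant modulo register `13`. All factors are below `B`, so products fit
into a word. -/
theorem runs_powerLoop {b B : ℕ} {mem : ℕ → ℕ} (hB : B * B < 2 ^ b) (h2 : 2 ≤ B) (k : ℕ) :
    ∀ s : ℕ → ℕ, s 17 = k → s 3 = 1 → s 4 = 2 → 0 < s 13 → s 13 ≤ B → s 14 < B → s 16 < s 13 →
      s 15 < 2 ^ b → k < 2 ^ b → ∃ s', Runs b mem powerLoop s (12 * k + 1) s' ∧
        s' 16 = s 16 * s 14 ^ (s 15 % 2 ^ k) % s 13 ∧ ∀ r, r < 14 ∨ 19 < r → s' r = s r := by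
  induction k with
  | zero =>
    intro s h17 _ _ _ _ _ h16 _ _
    refine ⟨s, .loopZero h17, ?_, fun _ _ => rfl⟩
    rw [pow_zero, Nat.mod_one, pow_zero, mul_one, Nat.mod_eq_of_lt h16]
  | succ k ih =>
    intro s h17 h3 h4 h13 h13B h14 h16 h15 hk
    -- The base or `1`, selected arithmetically by the current bit. Without a branch the number of
    -- steps does not depend on the exponent.
    obtain ⟨f, hf⟩ : ∃ f, f = 1 - s 15 % 2 + s 15 % 2 * s 14 := ⟨_, rfl⟩
    have hbit : s 15 % 2 = 0 ∨ s 15 % 2 = 1 := by omega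
    have hfp : f = s 14 ^ (s 15 % 2) := by
      rcases hbit with h | h <;> simp [hf, h]
    have hfB : f < B := by rcases hbit with h | h <;> rw [hfp, h] <;> simp <;> omega
    have hBB : B ≤ B * B := Nat.le_mul_self B
    have hbk : s 15 % 2 * s 14 < B := by rcases hbit with h | h <;> rw [h] <;> omega
    have haf : s 16 * f < 2 ^ b := by
      have : s 16 * f ≤ B * B := Nat.mul_le_mul (by omega) hfB.le
      omega
    have hkk : s 14 * s 14 < 2 ^ b := by
      have : s 14 * s 14 ≤ B * B := Nat.mul_le_mul h14.le h14.le
      omega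
    have hm1 : s 16 * f % s 13 < s 13 := Nat.mod_lt _ h13
    have hm2 : s 14 * s 14 % s 13 < s 13 := Nat.mod_lt _ h13
    let is : List Instr := [.arith .mod 18 15 4, .arith .div 15 15 4, .arith .sub 19 3 18,
      .arith .mul 18 18 14, .arith .add 19 19 18, .arith .mul 16 16 19, .arith .mod 16 16 13,
      .arith .mul 14 14 14, .arith .mod 14 14 13, .arith .sub 17 17 3]
    have hfit : BlockFits b mem s is := by
      simp only [is, BlockFits, Instr.Fits, Instr.assigned, BinOp.eval, Function.update_apply, h3, h4,
        h17]
      simp only [Nat.reduceEqDiff, if_true, if_false, ← hf]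
      refine ⟨?_, ?_, ?_, ?_, ?_, ?_, ?_, ?_, ?_, ?_, trivial⟩ <;> omega
    set s₁ := blockResult mem s is with hs₁
    have e17 : s₁ 17 = k := by simp [hs₁, is, blockResult, Instr.assigned, BinOp.eval, h3, h17]
    have e14 : s₁ 14 = s 14 * s 14 % s 13 := by
      simp [hs₁, is, blockResult, Instr.assigned, BinOp.eval]
    have e15 : s₁ 15 = s 15 / 2 := by simp [hs₁, is, blockResult, Instr.assigned, BinOp.eval, h4]
    have e16 : s₁ 16 = s 16 * f % s 13 := by
      simp [hs₁, is, blockResult, Instr.assigned, BinOp.eval, h3, h4, hf]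
    have er : ∀ r, r < 14 ∨ 19 < r → s₁ r = s r := by
      intro r hr
      have n14 : r ≠ 14 := by omega
      have n15 : r ≠ 15 := by omega
      have n16 : r ≠ 16 := by omega
      have n17 : r ≠ 17 := by omega
      have n18 : r ≠ 18 := by omega
      have n19 : r ≠ 19 := by omega
      simp [hs₁, is, blockResult, Instr.assigned, n14, n15, n16, n17, n18, n19]
    have e3 := er 3 (by norm_num)
    have e4 := er 4 (by norm_num)
    have e13 := er 13 (by norm_num)
    obtain ⟨s', hr, g16, gr⟩ := ih s₁ e17 (e3.trans h3) (e4.trans h4) (by omega) (by omega)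
      (by omega) (by omega) (by omega) (by omega)
    refine ⟨s', ?_, ?_, fun r h => (gr r h).trans (er r h)⟩
    · have := Runs.loopSucc (r := 17) (by omega) (.block hfit) hr
      exact this.congr_steps (by simp only [is, List.length_cons, List.length_nil]; ring)
    · rw [g16, e16, e14, e15, e13, hfp]
      have h5 : s 15 % 2 ^ (k + 1) = s 15 % 2 + 2 * (s 15 / 2 % 2 ^ k) := by
        rw [pow_succ', Nat.mod_mul]
      have h6 : s 16 * s 14 ^ (s 15 % 2 ^ (k + 1)) =
          s 16 * s 14 ^ (s 15 % 2) * (s 14 * s 14) ^ (s 15 / 2 % 2 ^ k) := by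
        rw [h5, pow_add, pow_mul, pow_two, mul_assoc]
      rw [h6]
      exact ((Nat.mod_modEq _ _).mul ((Nat.mod_modEq _ _).pow _))

/-- Here `r` rounds are done and `k` remain; register `9` holds the digits of `j` not yet read. The
exponent appears as `i % 2 ^ z` because the power loop reads exactly `z` binary digits. -/
theorem runs_roundLoop {b B j i z R : ℕ} {mem : ℕ → ℕ} (hB : B * B < 2 ^ b) (h2 : 2 ≤ B)
    (hR : (B ^ 2) ^ R < 2 ^ b) (k : ℕ) :
    ∀ (s : ℕ → ℕ) (r : ℕ), r + k = R → s 8 = k → s 1 = 0 → s 3 = 1 → s 4 = 2 → s 6 = B → s 7 = z →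
      s 9 = j / (B ^ 2) ^ r → s 10 = i → s 11 = roundWeight B j (i % 2 ^ z) r →
      s 12 = (B ^ 2) ^ r → s 20 = B * B → j < 2 ^ b → i < 2 ^ b → z < 2 ^ b → k < 2 ^ b →
      ∃ s', Runs b mem roundLoop s (k * (12 * z + 15) + 1) s' ∧
        s' 11 = roundWeight B j (i % 2 ^ z) R ∧ s' 12 = (B ^ 2) ^ R ∧ s' 0 = s 0 ∧ s' 1 = 0 := by
  induction k with
  | zero =>
    intro s r hr h8 h1 _ _ _ _ _ _ h11 h12 _ _ _ _ _
    obtain rfl : r = R := by omega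
    exact ⟨s, (Runs.loopZero h8).congr_steps (by ring), h11, h12, rfl, h1⟩
  | succ k ih =>
    intro s r hr h8 h1 h3 h4 h6 h7 h9 h10 h11 h12 h20 hj hi hz hk
    have hB0 : 0 < B := by omega
    have hBb : B ≤ B * B := Nat.le_mul_self B
    obtain ⟨d, hd⟩ : ∃ d, d = j / (B ^ 2) ^ r := ⟨_, rfl⟩
    rw [← hd] at h9
    have hdj : d ≤ j := hd ▸ Nat.div_le_self _ _
    have hdB : d % B < B := Nat.mod_lt _ hB0
    have hdB' : d / B % B < B := Nat.mod_lt _ hB0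
    have hdd : d / B ≤ d := Nat.div_le_self _ _
    have hdd' : d / B / B ≤ d / B := Nat.div_le_self _ _
    -- The power starts from `1` reduced by the modulus, since the modulus may be `1`.
    have hacc : 1 % (d % B + 1) < d % B + 1 := Nat.mod_lt _ (Nat.succ_pos _)
    let is : List Instr := [.arith .mod 13 9 6, .arith .add 13 13 3, .arith .div 9 9 6,
      .arith .mod 14 9 6, .arith .div 9 9 6, .arith .add 15 10 1, .arith .mod 16 3 13,
      .arith .add 17 7 1]
    have hfit : BlockFits b mem s is := by
      simp only [is, BlockFits, Instr.Fits, Instr.assigned, BinOp.eval, Function.update_apply]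
      simp only [Nat.reduceEqDiff, if_true, if_false, h1, h3, h6, h7, h9, h10]
      refine ⟨?_, ?_, ?_, ?_, ?_, ?_, ?_, ?_, trivial⟩ <;> omega
    set s₁ := blockResult mem s is with hs₁
    have e9 : s₁ 9 = d / B / B := by simp [hs₁, is, blockResult, Instr.assigned, BinOp.eval, h6, h9]
    have e13 : s₁ 13 = d % B + 1 := by
      simp [hs₁, is, blockResult, Instr.assigned, BinOp.eval, h3, h6, h9]
    have e14 : s₁ 14 = d / B % B := by simp [hs₁, is, blockResult, Instr.assigned, BinOp.eval, h6, h9]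
    have e15 : s₁ 15 = i := by simp [hs₁, is, blockResult, Instr.assigned, BinOp.eval, h1, h10]
    have e16 : s₁ 16 = 1 % (d % B + 1) := by
      simp [hs₁, is, blockResult, Instr.assigned, BinOp.eval, h3, h6, h9]
    have e17 : s₁ 17 = z := by simp [hs₁, is, blockResult, Instr.assigned, BinOp.eval, h1, h7]
    have er : ∀ r, r < 9 ∨ 9 < r ∧ r < 13 ∨ 17 < r → s₁ r = s r := by
      intro r hr
      have n9 : r ≠ 9 := by omega
      have n13 : r ≠ 13 := by omega
      have n14 : r ≠ 14 := by omega
      have n15 : r ≠ 15 := by omega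
      have n16 : r ≠ 16 := by omega
      have n17 : r ≠ 17 := by omega
      simp [hs₁, is, blockResult, Instr.assigned, n9, n13, n14, n15, n16, n17]
    obtain ⟨s₂, hr₂, g16, gr⟩ := runs_powerLoop (mem := mem) hB h2 z s₁ e17
      ((er 3 (by norm_num)).trans h3) ((er 4 (by norm_num)).trans h4) (by omega) (by omega)
      (by omega) (by omega) (by omega) hz
    have g : ∀ r, r < 9 ∨ 9 < r ∧ r < 13 ∨ 19 < r → s₂ r = s r := fun r hr =>
      (gr r (by omega)).trans (er r (by omega))
    have g16' : s₂ 16 = digitWeight B d (i % 2 ^ z) := by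
      rw [g16, e16, e13, e14, e15, digitWeight]
      conv_rhs => rw [← one_mul ((d / B % B) ^ (i % 2 ^ z))]
      exact (Nat.mod_modEq _ _).mul_right _
    have hdw : digitWeight B d (i % 2 ^ z) < B :=
      (Nat.mod_lt _ (Nat.succ_pos _)).trans_le hdB
    have hrw : roundWeight B j (i % 2 ^ z) r * B + digitWeight B d (i % 2 ^ z) =
        roundWeight B j (i % 2 ^ z) (r + 1) := by rw [roundWeight, hd]
    have hpow : ∀ t ≤ R, (B ^ 2) ^ t < 2 ^ b := fun t ht =>
      (Nat.pow_le_pow_right (by positivity) ht).trans_lt hR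
    have hrwlt : roundWeight B j (i % 2 ^ z) (r + 1) < 2 ^ b := by
      have h5 := roundWeight_lt hB0 j (i % 2 ^ z) (r + 1)
      have h6 : B ^ (r + 1) ≤ (B ^ 2) ^ (r + 1) :=
        Nat.pow_le_pow_left (Nat.le_self_pow two_ne_zero B) _
      exact h5.trans_le (h6.trans (hpow _ (by omega)).le)
    have hp12 : (B ^ 2) ^ r * (B * B) = (B ^ 2) ^ (r + 1) := by rw [pow_succ (B ^ 2) r, pow_two B]
    have hp12' := hpow (r + 1) (by omega)
    let is' : List Instr := [.arith .mul 11 11 6, .arith .add 11 11 16, .arith .mul 12 12 20,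
      .arith .sub 8 8 3]
    have a0 := g 0 (by norm_num)
    have a1 := (g 1 (by norm_num)).trans h1
    have a3 := (g 3 (by norm_num)).trans h3
    have a4 := (g 4 (by norm_num)).trans h4
    have a6 := (g 6 (by norm_num)).trans h6
    have a7 := (g 7 (by norm_num)).trans h7
    have a8 := (g 8 (by norm_num)).trans h8
    have a10 := (g 10 (by norm_num)).trans h10
    have a11 := (g 11 (by norm_num)).trans h11
    have a12 := (g 12 (by norm_num)).trans h12
    have a20 := (g 20 (by norm_num)).trans h20
    have a9 : s₂ 9 = d / B / B := (gr 9 (by norm_num)).trans e9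
    have hfit' : BlockFits b mem s₂ is' := by
      simp only [is', BlockFits, Instr.Fits, Instr.assigned, BinOp.eval, Function.update_apply]
      simp only [Nat.reduceEqDiff, if_true, if_false, a3, a6, a8, a11, a12, a20, g16', hp12, hrw]
      refine ⟨?_, ?_, ?_, ?_, trivial⟩ <;> omega
    set s₃ := blockResult mem s₂ is' with hs₃
    have c8 : s₃ 8 = k := by simp [hs₃, is', blockResult, Instr.assigned, BinOp.eval, a3, a8]
    have c11 : s₃ 11 = roundWeight B j (i % 2 ^ z) (r + 1) := by
      simp [hs₃, is', blockResult, Instr.assigned, BinOp.eval, a6, a11, g16', hrw]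
    have c12 : s₃ 12 = (B ^ 2) ^ (r + 1) := by
      simp only [hs₃, is', blockResult, Instr.assigned, BinOp.eval, Function.update_apply]
      simp only [Nat.reduceEqDiff, if_true, if_false, a12, a20, hp12]
    have cr : ∀ r, r ≠ 8 → r ≠ 11 → r ≠ 12 → s₃ r = s₂ r := fun r n8 n11 n12 => by
      simp [hs₃, is', blockResult, Instr.assigned, n8, n11, n12]
    have hd' : d / B / B = j / (B ^ 2) ^ (r + 1) := by
      rw [hd, Nat.div_div_eq_div_mul, Nat.div_div_eq_div_mul, hp12]
    obtain ⟨s', hr', f11, f12, f0, f1⟩ := ih s₃ (r + 1) (by omega) c8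
      ((cr 1 (by norm_num) (by norm_num) (by norm_num)).trans a1)
      ((cr 3 (by norm_num) (by norm_num) (by norm_num)).trans a3)
      ((cr 4 (by norm_num) (by norm_num) (by norm_num)).trans a4)
      ((cr 6 (by norm_num) (by norm_num) (by norm_num)).trans a6)
      ((cr 7 (by norm_num) (by norm_num) (by norm_num)).trans a7)
      ((cr 9 (by norm_num) (by norm_num) (by norm_num)).trans (a9.trans hd'))
      ((cr 10 (by norm_num) (by norm_num) (by norm_num)).trans a10) c11 c12
      ((cr 20 (by norm_num) (by norm_num) (by norm_num)).trans a20) hj hi hz (by omega)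
    refine ⟨s', ?_, f11, f12,
      f0.trans ((cr 0 (by norm_num) (by norm_num) (by norm_num)).trans a0), f1⟩
    have := Runs.loopSucc (r := 8) (by omega) (.seq (.block hfit) (.seq hr₂ (.block hfit'))) hr'
    exact this.congr_steps (by simp only [is, is', List.length_cons, List.length_nil]; ring)

/-- The base of the digits that encode a weight vector. -/
def digitBase (m : ℕ) : ℕ := (2 ^ (Nat.size m + 1)) ^ 64

/-- The number of rounds. -/
def numRounds (m : ℕ) : ℕ := Nat.size m + 2

/-- The number of weight vectors. -/
def numWeights (m : ℕ) : ℕ := (digitBase m ^ 2) ^ numRounds m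

/-- The number of steps of the computation of a weight. -/
def weightTime (m : ℕ) : ℕ := 5 * Nat.size m + numRounds m * (12 * Nat.size m + 15) + 19

/-- Cell `0` is reserved for the number of vectors, so processor `q` computes coordinate `(q - 1) %
m` of vector `(q - 1) / m`. The number of steps is independent of `q`. -/
theorem runs_weightCmd {b m q : ℕ} (hm : m < 2 ^ b) (hq : q < 2 ^ b) (hN : numWeights m < 2 ^ b) :
    ∃ s', Runs b (Function.update (fun _ => 0) 0 (m % 2 ^ b)) weightCmd
      (Function.update (fun _ => 0) 0 q) (weightTime m) s' ∧ s' 0 = q ∧ s' 1 = 0 ∧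
      s' 11 = roundWeight (digitBase m) ((q - 1) / m) ((q - 1) % m % 2 ^ Nat.size m) (numRounds m) ∧
      s' 12 = numWeights m := by
  set mem : ℕ → ℕ := Function.update (fun _ => 0) 0 (m % 2 ^ b) with hmem
  set s : ℕ → ℕ := Function.update (fun _ => 0) 0 q with hs
  have hmem0 : mem 0 = m := by simp [hmem, Nat.mod_eq_of_lt hm]
  have hsr : ∀ r, r ≠ 0 → s r = 0 := fun r hr => by simp [hs, hr]
  have hs0 : s 0 = q := by simp [hs]
  obtain ⟨z, hz⟩ : ∃ z, z = Nat.size m := ⟨_, rfl⟩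
  obtain ⟨M, hM⟩ : ∃ M, M = 2 ^ (z + 1) := ⟨_, rfl⟩
  have hBM : digitBase m = M ^ 64 := by rw [digitBase, hM, hz]
  have hM2 : 2 ≤ M := by
    rw [hM, pow_succ]
    have := Nat.one_le_two_pow (n := z)
    omega
  have hMpow : ∀ e f : ℕ, e ≤ f → M ^ e ≤ M ^ f := fun e f => Nat.pow_le_pow_right (by omega)
  -- `M ^ 128` is the square of the digit base, the largest number in the set-up. As `numWeights m`
  -- fits into a word, so do all intermediate powers of `M`.
  have hBB : M ^ 128 ≤ numWeights m := by
    rw [numWeights, hBM, ← pow_mul, ← pow_mul]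
    refine hMpow _ _ ?_
    rw [numRounds]
    omega
  have hzM : z + 2 < M ^ 2 := by
    have h1 : z < 2 ^ z := Nat.lt_two_pow_self
    have h2 : M = 2 * 2 ^ z := by rw [hM, pow_succ, mul_comm]
    nlinarith
  have hMb : ∀ e ≤ 128, M ^ e < 2 ^ b := fun e he => ((hMpow e 128 he).trans hBB).trans_lt hN
  have p1 := hMb 1 (by norm_num)
  rw [pow_one] at p1
  have p2 := hMb 2 (by norm_num)
  have p4 := hMb 4 (by norm_num)
  have p8 := hMb 8 (by norm_num)
  have p16 := hMb 16 (by norm_num)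
  have p32 := hMb 32 (by norm_num)
  have p64 := hMb 64 (by norm_num)
  have p128 := hMb 128 (by norm_num)
  have q2 : M * M = M ^ 2 := (pow_two M).symm
  have q4 : M ^ 2 * M ^ 2 = M ^ 4 := by rw [← pow_add]
  have q8 : M ^ 4 * M ^ 4 = M ^ 8 := by rw [← pow_add]
  have q16 : M ^ 8 * M ^ 8 = M ^ 16 := by rw [← pow_add]
  have q32 : M ^ 16 * M ^ 16 = M ^ 32 := by rw [← pow_add]
  have q64 : M ^ 32 * M ^ 32 = M ^ 64 := by rw [← pow_add]
  have q128 : M ^ 64 * M ^ 64 = M ^ 128 := by rw [← pow_add]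
  let is : List Instr := [.load 2 1, .const 3 1, .const 4 2, .arith .add 5 2 1, .arith .add 6 4 1]
  have hfit : BlockFits b mem s is := by
    simp only [is, BlockFits, Instr.Fits, Instr.assigned, BinOp.eval, Function.update_apply]
    simp only [Nat.reduceEqDiff, OfNat.one_ne_ofNat, if_true, if_false, hsr 1 one_ne_zero, hmem0]
    refine ⟨?_, ?_, ?_, ?_, ?_, trivial⟩ <;> omega
  set s₁ := blockResult mem s is with hs₁
  have e0 : s₁ 0 = q := by simp [hs₁, is, blockResult, Instr.assigned, hs0]
  have e1 : s₁ 1 = 0 := by simp [hs₁, is, blockResult, Instr.assigned, hsr]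
  have e2 : s₁ 2 = m := by simp [hs₁, is, blockResult, Instr.assigned, hsr, hmem0]
  have e3 : s₁ 3 = 1 := by simp [hs₁, is, blockResult, Instr.assigned]
  have e4 : s₁ 4 = 2 := by simp [hs₁, is, blockResult, Instr.assigned]
  have e5 : s₁ 5 = m := by simp [hs₁, is, blockResult, Instr.assigned, BinOp.eval, hsr, hmem0]
  have e6 : s₁ 6 = 2 := by simp [hs₁, is, blockResult, Instr.assigned, BinOp.eval, hsr]
  have e7 : s₁ 7 = 0 := by simp [hs₁, is, blockResult, Instr.assigned, hsr]
  have e11 : s₁ 11 = 0 := by simp [hs₁, is, blockResult, Instr.assigned, hsr]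
  have hM' : 2 * 2 ^ z = M := by rw [hM, pow_succ, mul_comm]
  obtain ⟨s₂, hr₂, g6, g7, gr⟩ := runs_sizeLoop (b := b) (mem := mem) z s₁ (by rw [e5, hz]) e3 e4
    (by rw [e6, hM']; exact p1) (by rw [e5]; exact hm) (by rw [e7]; omega)
  rw [e6, hM'] at g6
  rw [e7, zero_add] at g7
  have g0 : s₂ 0 = q := (gr 0 (by norm_num) (by norm_num) (by norm_num)).trans e0
  have g1 : s₂ 1 = 0 := (gr 1 (by norm_num) (by norm_num) (by norm_num)).trans e1
  have g2 : s₂ 2 = m := (gr 2 (by norm_num) (by norm_num) (by norm_num)).trans e2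
  have g3 : s₂ 3 = 1 := (gr 3 (by norm_num) (by norm_num) (by norm_num)).trans e3
  have g4 : s₂ 4 = 2 := (gr 4 (by norm_num) (by norm_num) (by norm_num)).trans e4
  have g11 : s₂ 11 = 0 := (gr 11 (by norm_num) (by norm_num) (by norm_num)).trans e11
  have hi : (q - 1) % m ≤ q - 1 := Nat.mod_le _ _
  have hj : (q - 1) / m ≤ q - 1 := Nat.div_le_self _ _
  let is' : List Instr := [.arith .mul 6 6 6, .arith .mul 6 6 6, .arith .mul 6 6 6, .arith .mul 6 6 6,
    .arith .mul 6 6 6, .arith .mul 6 6 6, .arith .add 8 7 4, .arith .sub 9 0 3,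
    .arith .mod 10 9 2, .arith .div 9 9 2, .const 12 1, .arith .mul 20 6 6]
  have hfit' : BlockFits b mem s₂ is' := by
    simp only [is', BlockFits, Instr.Fits, Instr.assigned, BinOp.eval, Function.update_apply]
    simp only [Nat.reduceEqDiff, OfNat.zero_ne_ofNat, if_true, if_false, g0, g2, g3, g4, g6, g7, q2,
      q4, q8, q16, q32, q64, q128]
    refine ⟨?_, ?_, ?_, ?_, ?_, ?_, ?_, ?_, ?_, ?_, ?_, ?_, trivial⟩ <;> omega
  set s₃ := blockResult mem s₂ is' with hs₃
  have c : ∀ r, r ≠ 6 → r ≠ 8 → r ≠ 9 → r ≠ 10 → r ≠ 12 → r ≠ 20 → s₃ r = s₂ r :=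
    fun r n6 n8 n9 n10 n12 n20 => by
      simp [hs₃, is', blockResult, Instr.assigned, n6, n8, n9, n10, n12, n20]
  have c6 : s₃ 6 = digitBase m := by
    simp [hs₃, is', blockResult, Instr.assigned, BinOp.eval, g6, q2, q4, q8, q16, q32, q64, hBM]
  have c8 : s₃ 8 = numRounds m := by
    simp [hs₃, is', blockResult, Instr.assigned, BinOp.eval, g4, g7, numRounds, hz]
  have c9 : s₃ 9 = (q - 1) / m := by
    simp [hs₃, is', blockResult, Instr.assigned, BinOp.eval, g0, g2, g3]
  have c10 : s₃ 10 = (q - 1) % m := by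
    simp [hs₃, is', blockResult, Instr.assigned, BinOp.eval, g0, g2, g3]
  have c12 : s₃ 12 = 1 := by simp [hs₃, is', blockResult, Instr.assigned]
  have c20 : s₃ 20 = digitBase m * digitBase m := by
    simp [hs₃, is', blockResult, Instr.assigned, BinOp.eval, g6, q2, q4, q8, q16, q32, q64, hBM]
  have hB2 : 2 ≤ digitBase m := by
    rw [hBM]
    calc 2 ≤ M ^ 1 := by simpa using hM2
      _ ≤ M ^ 64 := hMpow _ _ (by norm_num)
  obtain ⟨s', hr', f11, f12, f0, f1⟩ := runs_roundLoop (b := b) (mem := mem) (B := digitBase m)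
    (j := (q - 1) / m) (i := (q - 1) % m) (z := z) (R := numRounds m)
    (by rw [hBM, q128]; exact p128) hB2 hN (numRounds m) s₃ 0 (zero_add _) c8
    ((c 1 (by norm_num) (by norm_num) (by norm_num) (by norm_num) (by norm_num) (by norm_num)).trans g1)
    ((c 3 (by norm_num) (by norm_num) (by norm_num) (by norm_num) (by norm_num) (by norm_num)).trans g3)
    ((c 4 (by norm_num) (by norm_num) (by norm_num) (by norm_num) (by norm_num) (by norm_num)).trans g4)
    c6
    ((c 7 (by norm_num) (by norm_num) (by norm_num) (by norm_num) (by norm_num) (by norm_num)).trans g7)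
    (by rw [c9, pow_zero, Nat.div_one]) c10
    ((c 11 (by norm_num) (by norm_num) (by norm_num) (by norm_num) (by norm_num)
      (by norm_num)).trans g11)
    (by rw [c12, pow_zero]) c20 (by omega) (by omega) (by omega) (by rw [numRounds]; omega)
  refine ⟨s', ?_, ?_, f1, ?_, f12⟩
  · have := Runs.seq (.block hfit) (.seq hr₂ (.seq (.block hfit') hr'))
    exact this.congr_steps (by simp only [is, is', List.length_cons, List.length_nil, weightTime, ← hz]; ring)
  · rw [f0]
    exact (c 0 (by norm_num) (by norm_num) (by norm_num) (by norm_num) (by norm_num)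
      (by norm_num)).trans g0
  · rw [f11, hz]

end PRAM

/-! ### Quasi-polynomial bounds, choice of the parameters and the main theorem. -/

/-- The number of weight vectors is quasi-polynomially bounded. -/
theorem numWeights_le (m : ℕ) :
    PRAM.numWeights m ≤ 2 ^ (128 * ((Nat.log 2 m + 2) * (Nat.log 2 m + 3))) := by
  have hs : Nat.size m ≤ Nat.log 2 m + 1 := Nat.size_le.2 (Nat.lt_pow_succ_log_self one_lt_two m)
  rw [PRAM.numWeights, PRAM.digitBase, PRAM.numRounds, ← pow_mul, ← pow_mul,
    ← pow_mul]
  refine Nat.pow_le_pow_right two_pos ?_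
  have h1 : (Nat.size m + 1) * (Nat.size m + 2) ≤ (Nat.log 2 m + 2) * (Nat.log 2 m + 3) :=
    Nat.mul_le_mul (by omega) (by omega)
  calc (Nat.size m + 1) * (64 * (2 * (Nat.size m + 2)))
      = 128 * ((Nat.size m + 1) * (Nat.size m + 2)) := by ring
    _ ≤ _ := Nat.mul_le_mul_left _ h1

/-- The first bound gives a processor for every entry and one for cell `0`. For `m < 2` the
logarithm is `0` and only the constant `c` helps, against at most `2 ^ (128 * 2 * 3)` weight
vectors. For larger `m` the quadratic exponent is absorbed by `2 ^ L ≤ m`. -/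
theorem numWeights_mul_lt_quasiPolyBound {c : ℕ} (hc : 2000 ≤ c) (hc' : 4 * 2 ^ 768 ≤ c)
    (m : ℕ) :
    PRAM.numWeights m * m + 1 < quasiPolyBound c m ∧ PRAM.numWeights m ≤ quasiPolyBound c m := by
  have hN := numWeights_le m
  rcases Nat.lt_or_ge m 2 with hm | hm
  · have hL : Nat.log 2 m = 0 := Nat.log_of_lt hm
    have hq : quasiPolyBound c m = c := by simp [quasiPolyBound, hL]
    rw [hL] at hN
    have h1 : PRAM.numWeights m ≤ 2 ^ 768 := hN
    have h2 : PRAM.numWeights m * m ≤ PRAM.numWeights m * 1 := Nat.mul_le_mul_left _ (by omega)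
    rw [hq]
    generalize 2 ^ 768 = x at h1 hc'
    omega
  · obtain ⟨L, hL⟩ : ∃ L, L = Nat.log 2 m := ⟨_, rfl⟩
    have hL1 : 1 ≤ L := hL ▸ Nat.log_pos one_lt_two hm
    have hLm : 2 ^ L ≤ m := hL ▸ Nat.pow_log_le_self 2 (by omega)
    rw [← hL] at hN
    have h1 : PRAM.numWeights m ≤ m ^ (1536 * L) := by
      have h2 : 128 * ((L + 2) * (L + 3)) ≤ L * (1536 * L) := by
        have : (L + 2) * (L + 3) ≤ (3 * L) * (4 * L) := Nat.mul_le_mul (by omega) (by omega)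
        calc 128 * ((L + 2) * (L + 3)) ≤ 128 * ((3 * L) * (4 * L)) := Nat.mul_le_mul_left _ this
          _ = _ := by ring
      calc PRAM.numWeights m ≤ 2 ^ (L * (1536 * L)) := hN.trans (Nat.pow_le_pow_right two_pos h2)
        _ = (2 ^ L) ^ (1536 * L) := pow_mul _ _ _
        _ ≤ _ := Nat.pow_le_pow_left hLm _
    have h3 : m ^ (1536 * L) * m ≤ m ^ (c * L) := by
      rw [← pow_succ]
      refine Nat.pow_le_pow_right (by omega) ?_
      have : 2000 * L ≤ c * L := Nat.mul_le_mul_right L hc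
      omega
    have h4 : 1 ≤ m ^ (c * L) := Nat.one_le_pow _ _ (by omega)
    have h5 : PRAM.numWeights m * m ≤ m ^ (c * L) := (Nat.mul_le_mul_right _ h1).trans h3
    have h6 : PRAM.numWeights m ≤ m ^ (c * L) := by nlinarith
    have h7 : 3 * m ^ (c * L) ≤ c * m ^ (c * L) := Nat.mul_le_mul_right _ (by omega)
    rw [quasiPolyBound, ← hL]
    omega

/-- The input, the processor numbers and the largest computed value fit into words, as all of them
have `O(log² m)` binary digits. -/
theorem lt_two_pow_wordLength {c : ℕ} (hc : 2000 ≤ c) (m : ℕ) :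
    m < 2 ^ wordLength c m ∧ quasiPolyBound c m ≤ 2 ^ wordLength c m ∧
      PRAM.numWeights m < 2 ^ wordLength c m := by
  have hm := Nat.lt_pow_succ_log_self one_lt_two m
  have hN := numWeights_le m
  rw [quasiPolyBound, wordLength]
  generalize Nat.log 2 m = L at *
  refine ⟨hm.trans_le (Nat.pow_le_pow_right two_pos (by nlinarith)), ?_,
    hN.trans_lt (Nat.pow_lt_pow_right one_lt_two (by nlinarith))⟩
  calc c * m ^ (c * L) ≤ 2 ^ c * (2 ^ (L + 1)) ^ (c * L) :=
        Nat.mul_le_mul Nat.lt_two_pow_self.le (Nat.pow_le_pow_left hm.le _)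
    _ = 2 ^ (c + (L + 1) * (c * L)) := by rw [← pow_mul, ← pow_add]
    _ ≤ 2 ^ (c * (L + 1) ^ 2) := Nat.pow_le_pow_right two_pos (by nlinarith)

theorem weightTime_le_polylogBound {c : ℕ} (hc : 2000 ≤ c) (m : ℕ) :
    PRAM.weightTime m + 2 ≤ polylogBound c m := by
  have hs : Nat.size m ≤ Nat.log 2 m + 1 := Nat.size_le.2 (Nat.lt_pow_succ_log_self one_lt_two m)
  rw [PRAM.weightTime, PRAM.numRounds, polylogBound]
  generalize Nat.size m = s at *
  generalize Nat.log 2 m = L at *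
  have h1 : (L + 1) ^ 2 ≤ (L + 1) ^ c := Nat.pow_le_pow_right (by omega) (by omega)
  have h2 : 2000 * (L + 1) ^ 2 ≤ c * (L + 1) ^ c := Nat.mul_le_mul hc h1
  nlinarith

theorem exists_isolating_weight {K : Type*} [Field K] {n m : ℕ}
    {l : Fin m → Submodule K (Fin n → K)} (hl : ∀ i, Module.finrank K (l i) = 2) :
    ∃ j < PRAM.numWeights m,
      IsIsolating (fun i : Fin m => roundWeight (PRAM.digitBase m) j i (PRAM.numRounds m))
        (fractionalMatroidMatchingPolytope l) := by
  have hm := Nat.lt_size_self m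
  obtain ⟨M, hM⟩ : ∃ M, M = 2 ^ (Nat.size m + 1) := ⟨_, rfl⟩
  have hM' : M = 2 * 2 ^ Nat.size m := by rw [hM, pow_succ']
  have hmM : 2 * (m + 1) ≤ M := by omega
  -- The count of near-shortest vectors times `m` is at most `(M ^ 6) ^ 4 * (M ^ 2) ^ 3 * M`, which
  -- is `M ^ 31`. The base then has to exceed `4 * M ^ 31 * (m + 1)`, for which `M ^ 34` suffices;
  -- `M ^ 64` arises from `M` by six squarings.
  refine exists_isolating_roundWeight (Q := M ^ 31) hl ?_ ?_ ?_ ?_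
  · have h1 : 16 * (m + 1) ^ 2 ≤ M ^ 6 := by
      have h2 : 16 ≤ M ^ 4 := by
        calc 16 = 2 ^ 4 := by norm_num
          _ ≤ M ^ 4 := Nat.pow_le_pow_left (by omega) 4
      calc 16 * (m + 1) ^ 2 ≤ M ^ 4 * M ^ 2 := Nat.mul_le_mul h2 (Nat.pow_le_pow_left (by omega) 2)
        _ = M ^ 6 := by ring
    have h3 : 2 * (m + 1) + 1 ≤ M ^ 2 := by nlinarith
    calc (16 * (m + 1) ^ 2) ^ 4 * (2 * (m + 1) + 1) ^ 3 * m ≤ (M ^ 6) ^ 4 * (M ^ 2) ^ 3 * M :=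
          Nat.mul_le_mul (Nat.mul_le_mul (Nat.pow_le_pow_left h1 4) (Nat.pow_le_pow_left h3 3))
            (by omega)
      _ = M ^ 31 := by ring
  · calc 2 ^ PRAM.numRounds m = 2 * M := by rw [PRAM.numRounds, hM, pow_succ']
      _ ≤ M ^ 30 * M := Nat.mul_le_mul_right _ (by
          calc 2 ≤ M := by omega
            _ ≤ M ^ 30 := Nat.le_self_pow (by norm_num) M)
      _ = M ^ 31 := by ring
  · calc 4 * M ^ 31 * (m + 1) < 4 * M ^ 31 * M := by
          refine Nat.mul_lt_mul_of_pos_left (by omega) ?_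
          have : 0 < M := by omega
          positivity
      _ ≤ M ^ 2 * M ^ 31 * M := Nat.mul_le_mul_right _ (Nat.mul_le_mul_right _ (by nlinarith))
      _ = M ^ 34 := by ring
      _ ≤ M ^ 64 := Nat.pow_le_pow_right (by omega) (by norm_num)
      _ = PRAM.digitBase m := by rw [PRAM.digitBase, hM]
  · rw [PRAM.numRounds, pow_succ, ← hM]
    omega

theorem mainTheorem2 :
    ∃ (prog : PRAM.Program) (c : ℕ), ∀ m : ℕ,
      ∃ t ≤ polylogBound c m, ∃ σ : PRAM.Config (quasiPolyBound c m),
        σ = PRAM.run prog (wordLength c m) (quasiPolyBound c m) m t ∧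
        σ.Halted prog ∧
        (σ.output m).card ≤ quasiPolyBound c m ∧
        (∀ w ∈ σ.output m, ∀ i, w i ≤ quasiPolyBound c m) ∧
        ∀ (K : Type*) [Field K] (n : ℕ) (l : Fin m → Submodule K (Fin n → K)),
          (∀ i, Module.finrank K (l i) = 2) →
          ∃ w ∈ σ.output m, IsIsolating w (fractionalMatroidMatchingPolytope l) := by
  obtain ⟨c, hc', hc⟩ : ∃ c, 2000 ≤ c ∧ 4 * 2 ^ 768 ≤ c :=
    ⟨2000 + 4 * 2 ^ 768, Nat.le_add_right _ _, Nat.le_add_left _ _⟩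
  refine ⟨PRAM.weightCmd.compile 0 ++ [.store 0 11, .store 1 12], c, fun m => ?_⟩
  obtain ⟨hp, hNp⟩ := numWeights_mul_lt_quasiPolyBound hc' hc m
  obtain ⟨hmb, hpb, hNb⟩ := lt_two_pow_wordLength hc' m
  obtain ⟨σ, hσ, hhalt, h0, hval⟩ := PRAM.exists_run_of_runs (rZero := 1) (rVal := 11) (rTot := 12)
    (input := m) (by omega) hpb fun q hq => PRAM.runs_weightCmd hmb (hq.trans_le hpb) hNb
  have hcell : ∀ j < PRAM.numWeights m, ∀ i : Fin m, σ.mem (1 + j * m + i) =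
      roundWeight (PRAM.digitBase m) j i (PRAM.numRounds m) := by
    intro j hj i
    have hi := i.2
    have h1 : j * m + m ≤ PRAM.numWeights m * m := by
      rw [← Nat.succ_mul]
      exact Nat.mul_le_mul_right _ hj
    -- The processor that writes this cell decodes its number by division with remainder; the
    -- existence of `i` makes `m` positive, and `i < m < 2 ^ Nat.size m` makes the truncation of the
    -- exponent harmless.
    have h2 : 1 + j * m + i - 1 = i + m * j := by rw [mul_comm m j]; omega
    rw [hval _ (by omega) (by omega), h2, Nat.add_mul_div_left _ _ (by omega),
      Nat.div_eq_of_lt hi, zero_add, Nat.add_mul_mod_self_left, Nat.mod_eq_of_lt hi,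
      Nat.mod_eq_of_lt (hi.trans (Nat.lt_size_self m))]
  refine ⟨_, weightTime_le_polylogBound hc' m, σ, hσ, hhalt, ?_, ?_, ?_⟩
  · refine Finset.card_image_le.trans ?_
    rw [Finset.card_range, h0]
    exact hNp
  · intro w hw i
    obtain ⟨j, hj, rfl⟩ := Finset.mem_image.1 hw
    rw [Finset.mem_range, h0] at hj
    simp only
    rw [hcell j hj i]
    have hB : 0 < PRAM.digitBase m := by unfold PRAM.digitBase; positivity
    calc roundWeight (PRAM.digitBase m) j i (PRAM.numRounds m)
        ≤ PRAM.digitBase m ^ PRAM.numRounds m := (roundWeight_lt hB _ _ _).le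
      _ ≤ PRAM.numWeights m := Nat.pow_le_pow_left (Nat.le_self_pow two_ne_zero _) _
      _ ≤ _ := hNp
  · intro K _ n l hl
    obtain ⟨j, hj, hiso⟩ := exists_isolating_weight hl
    refine ⟨_, Finset.mem_image.2 ⟨j, by rwa [Finset.mem_range, h0], rfl⟩, ?_⟩
    convert hiso using 2 with i
    exact hcell j hj i
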